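/- Let $B$ be a complex manifold (of any finite dimension) carrying a polarized real variation of Hodge structure of weight $1$: a flat complex vector bundle $H^1_{\mathbb C}$ of finite rank with flat (Gauss–Manin) connection $\nabla$, a flat real subbundle $H^1_{\mathbb R}$ with $H^1_{\mathbb C}=H^1_{\mathbb R}\otimes\mathbb C$, a flat real alternating form $Q$, and a holomorphic subbundle $H^{1,0}\subset H^1_{\mathbb C}$ such that, with $H^{0,1}:=\overline{H^{1,0}}$, one has $H^1_{\mathbb C}=H^{1,0}\oplus H^{0,1}$, $Q(u,v)=0$ for $u,v\in H^{1,0}$, and $iQ(u,\bar u)>0$ for $0\neq u\in H^{1,0}$. Let $\langle u,v\rangle=Q(Cu,\bar v)$ be the positive definite Hodge metric, where $C=i$ on $H^{1,0}$ and $C=-i$ on $H^{0,1}$. All norms (including the induced norms on exterior powers), adjoints and orthogonal projections are taken with respect to it. Let $\sigma:H^{1,0}\to\Omega^1\otimes H^{0,1}$ be the second fundamental form, $\sigma(s)=\pi^{0,1}(\nabla s)$ for sections $s$ of $H^{1,0}$, and let $\sigma^\dagger$ be its adjoint, a $(0,1)$-form with values in $\mathrm{Hom}(H^{0,1},H^{1,0})$.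 Let $U\subset B$ be a connected open set, $b\in U$, and let $c_1,\dots,c_k$ be flat sections of $H^1_{\mathbb R}$ over $U$ whose values at $b$ form a basis of a $Q$-isotropic subspace of $H^1_{\mathbb R}|_b$. Let $\phi_i=\pi^{0,1}(c_i)$ be the projection of $c_i$ to $H^{0,1}\cong H^1_{\mathbb C}/H^{1,0}$. Then over $U$ the $\phi_i$ are holomorphic sections of $H^{0,1}$ (with its holomorphic structure as the quotient $H^1_{\mathbb C}/H^{1,0}$), and they are linearly independent at every point, so that they span a $k$-dimensional subbundle $\mathcal C\subset H^{0,1}$. Moreover $\|c_1\wedge\dots\wedge c_k\|^2$ is positive on $U$, its logarithm is smooth, and the following equality of $(1,1)$-forms holds on $U$: $$\partial\bar\partial\log\|c_1\wedge\cdots\wedge c_k\|^2=\operatorname{tr}(\sigma\wedge\sigma^\dagger)-\operatorname{tr}\bigl(\sigma\wedge\pi_{\overline{\mathcal C}^{\perp}}\,\sigma^\dagger\,\pi_{\mathcal C^\perp}\bigr).$$ Here $\mathcal C^\perp$ is the orthogonal complement of $\mathcal C$ inside $H^{0,1}$, $\overline{\mathcal C}^{\perp}\subset H^{1,0}$ is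 the complex conjugate of $\mathcal C^\perp$, and $\pi_{\mathcal C^\perp}$, $\pi_{\overline{\mathcal C}^\perp}$ are the orthogonal projections onto these subbundles. -/

import Mathlib

open scoped Manifold ContDiff Topology
open Bundle Complex

noncomputable section

/-! ### Linear algebra over a positive definite Hermitian form -/

namespace HermitianLinearAlgebra

variable {W : Type*} [AddCommGroup W] [Module ℂ W]

/-- The adjoint of an endomorphism of a finite-dimensional space with respect to a positive
definite Hermitian form. -/
def adjoint [FiniteDimensional ℂ W] (h : InnerProductSpace.Core ℂ W) (T : W →ₗ[ℂ] W) :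
    W →ₗ[ℂ] W :=
  letI : NormedAddCommGroup W := h.toNormedAddCommGroup
  letI : InnerProductSpace ℂ W := InnerProductSpace.ofCore h.toCore
  LinearMap.adjoint T

/-- The orthogonal complement of a subspace with respect to a positive definite Hermitian form. -/
def orthogonal (h : InnerProductSpace.Core ℂ W) (K : Submodule ℂ W) : Submodule ℂ W :=
  letI : NormedAddCommGroup W := h.toNormedAddCommGroup
  letI : InnerProductSpace ℂ W := InnerProductSpace.ofCore h.toCore
  Kᗮ

/-- The orthogonal projection onto a subspace of a finite-dimensional space with respect to a
positive definite Hermitian form. -/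
def orthogonalProjection [FiniteDimensional ℂ W] (h : InnerProductSpace.Core ℂ W)
    (K : Submodule ℂ W) : W →ₗ[ℂ] W :=
  letI : NormedAddCommGroup W := h.toNormedAddCommGroup
  letI : InnerProductSpace ℂ W := InnerProductSpace.ofCore h.toCore
  (K.starProjection : W →L[ℂ] W).toLinearMap

theorem adjoint_spec [FiniteDimensional ℂ W] (h : InnerProductSpace.Core ℂ W) (T : W →ₗ[ℂ] W)
    (u v : W) : h.inner (T u) v = h.inner u (adjoint h T v) := by
  let : NormedAddCommGroup W := h.toNormedAddCommGroup
  let : InnerProductSpace ℂ W := InnerProductSpace.ofCore h.toCore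
  exact (LinearMap.adjoint_inner_right T u v).symm

theorem mem_orthogonal (h : InnerProductSpace.Core ℂ W) (K : Submodule ℂ W) (v : W) :
    v ∈ orthogonal h K ↔ ∀ u ∈ K, h.inner u v = 0 := by
  let : NormedAddCommGroup W := h.toNormedAddCommGroup
  let : InnerProductSpace ℂ W := InnerProductSpace.ofCore h.toCore
  exact Submodule.mem_orthogonal K v

theorem orthogonalProjection_spec [FiniteDimensional ℂ W] (h : InnerProductSpace.Core ℂ W)
    (K : Submodule ℂ W) (v : W) :
    orthogonalProjection h K v ∈ K ∧ v - orthogonalProjection h K v ∈ orthogonal h K := by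
  let : NormedAddCommGroup W := h.toNormedAddCommGroup
  let : InnerProductSpace ℂ W := InnerProductSpace.ofCore h.toCore
  exact ⟨K.starProjection_apply_mem v, K.sub_starProjection_mem_orthogonal v⟩

end HermitianLinearAlgebra

/-! ### The operators `∂`, `∂̄` on functions, and the `(1,1)`-form `∂∂̄ f` -/

section Dolbeault

variable {E : Type*} [NormedAddCommGroup E] [NormedSpace ℂ E]

/-- The `(1,0)`-part `∂g` of the differential of `g`, evaluated on the real tangent vector `u`. -/
def delFun (g : E → ℂ) (z : E) (u : E) : ℂ :=
  (1 / 2 : ℂ) * (fderiv ℝ g z u - I * fderiv ℝ g z (I • u))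

/-- The `(0,1)`-part `∂̄g` of the differential of `g`, evaluated on the real tangent vector `u`. -/
def delbarFun (g : E → ℂ) (z : E) (u : E) : ℂ :=
  (1 / 2 : ℂ) * (fderiv ℝ g z u + I * fderiv ℝ g z (I • u))

/-- The `(1,1)`-form `∂∂̄f` on a complex manifold, as a complex-valued alternating form on real
tangent vectors, computed in the holomorphic chart at `x` (in coordinates it is
`∑ ∂²f/∂zᵢ∂z̄ⱼ dzᵢ ∧ dz̄ⱼ`, with `(α ∧ β)(u, v) = α(u)β(v) - α(v)β(u)`). -/
def ddbar {B : Type*} [TopologicalSpace B] [ChartedSpace E B] (f : B → ℂ) (x : B)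
    (u v : TangentSpace 𝓘(ℂ, E) x) : ℂ :=
  let g : E → ℂ := fun z => f ((extChartAt 𝓘(ℂ, E) x).symm z)
  let z₀ : E := extChartAt 𝓘(ℂ, E) x x
  delFun (fun z => delbarFun g z v) z₀ u - delFun (fun z => delbarFun g z u) z₀ v

/-- The derivative of a vector-valued function on the complex manifold `B` along the real tangent
vector `u` at `x`. -/
def dirDeriv {B : Type*} [TopologicalSpace B] [ChartedSpace E B]
    {G : Type*} [NormedAddCommGroup G] [NormedSpace ℝ G] (g : B → G) (x : B)
    (u : TangentSpace 𝓘(ℂ, E) x) : G :=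
  let dg : E →L[ℝ] G := mfderiv 𝓘(ℝ, E) 𝓘(ℝ, G) g x
  dg u

/-- The wedge product `α ∧ β` of two `1`-forms with values in the endomorphisms of `W`,
evaluated on a pair of tangent vectors. -/
def wedgeEnd {T W : Type*} [AddCommGroup W] [Module ℂ W] (α β : T → (W →ₗ[ℂ] W)) (u v : T) :
    W →ₗ[ℂ] W :=
  α u ∘ₗ β v - α v ∘ₗ β u

end Dolbeault

/-! ### Flat bundles -/

section Flat

variable {B : Type*} [TopologicalSpace B] (F : Type*) [NormedAddCommGroup F] [NormedSpace ℂ F]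
  (V : B → Type*) [∀ x, AddCommGroup (V x)] [∀ x, Module ℂ (V x)] [∀ x, TopologicalSpace (V x)]
  [TopologicalSpace (TotalSpace F V)] [FiberBundle F V] [VectorBundle ℂ F V]

/-- A flat complex vector bundle: the transition functions between the trivializations of its
atlas are locally constant. -/
class IsFlatBundle : Prop where
  eventually_coordChange_eq : ∀ (e e' : Trivialization F (TotalSpace.proj : TotalSpace F V → B))
    [MemTrivializationAtlas e] [MemTrivializationAtlas e'], ∀ x ∈ e.baseSet ∩ e'.baseSet,
    ∀ᶠ y in 𝓝 x, e.coordChangeL ℂ e' y = e.coordChangeL ℂ e' x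

variable {V}

/-- The section `s` is flat near `x`: in every flat trivialization it is constant near `x`. -/
def IsFlatAt (s : ∀ y, V y) (x : B) : Prop :=
  ∀ (e : Trivialization F (TotalSpace.proj : TotalSpace F V → B)) [MemTrivializationAtlas e],
    x ∈ e.baseSet → ∀ᶠ y in 𝓝 x, (e ⟨y, s y⟩).2 = (e ⟨x, s x⟩).2

variable (E : Type*) [NormedAddCommGroup E] [NormedSpace ℂ E] [ChartedSpace E B]

/-- The section `s` is holomorphic near `x`, for the holomorphic structure on `V` in which flat
sections are holomorphic. -/
def IsHolomorphicAt (s : ∀ y, V y) (x : B) : Prop :=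
  ∀ (e : Trivialization F (TotalSpace.proj : TotalSpace F V → B)) [MemTrivializationAtlas e],
    x ∈ e.baseSet → ContMDiffAt 𝓘(ℂ, E) 𝓘(ℂ, F) ω (fun y => (e ⟨y, s y⟩).2) x

/-- The flat (Gauss-Manin) connection: `∇_u s` at `x` is the derivative of `s` along `u` in a flat
trivialization around `x`. -/
def gaussManin (s : ∀ y, V y) (x : B) (u : TangentSpace 𝓘(ℂ, E) x) : V x :=
  (trivializationAt F V x).symm x
    (dirDeriv (fun y => (trivializationAt F V x ⟨y, s y⟩).2) x u)

end Flat

/-- The subspace of the fiber at `x` spanned by the sections `φ_1, …, φ_k`. -/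
def spanAt {B : Type*} {V : B → Type*} [∀ x, AddCommGroup (V x)] [∀ x, Module ℂ (V x)]
    {k : ℕ} (φ : Fin k → ∀ y, V y) (x : B) : Submodule ℂ (V x) :=
  Submodule.span ℂ (Set.range fun i => φ i x)

/-! ### Polarized variations of Hodge structure of weight one -/

/-- A polarized real variation of Hodge structure of weight one on the flat bundle `V = H¹_ℂ` over
the complex manifold `B`. -/
structure PolarizedVHS {B : Type*} [TopologicalSpace B]
    (E : Type*) [NormedAddCommGroup E] [NormedSpace ℂ E] [ChartedSpace E B]
    (F : Type*) [NormedAddCommGroup F] [NormedSpace ℂ F]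
    (V : B → Type*) [∀ x, AddCommGroup (V x)] [∀ x, Module ℂ (V x)] [∀ x, TopologicalSpace (V x)]
    [TopologicalSpace (TotalSpace F V)] [FiberBundle F V] [VectorBundle ℂ F V] where
  /-- complex conjugation with respect to the flat real subbundle `H¹_ℝ` -/
  conj : ∀ x, V x →ₛₗ[starRingEnd ℂ] V x
  conj_conj : ∀ x v, conj x (conj x v) = v
  conj_flat : ∀ (s : ∀ y, V y) (x : B), IsFlatAt F s x → IsFlatAt F (fun y => conj y (s y)) x
  /-- the polarization, extended complex bilinearly -/
  Q : ∀ x, V x →ₗ[ℂ] V x →ₗ[ℂ] ℂ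
  Q_self : ∀ x v, Q x v v = 0
  Q_conj : ∀ x u v, Q x (conj x u) (conj x v) = starRingEnd ℂ (Q x u v)
  Q_flat : ∀ (s t : ∀ y, V y) (x : B), IsFlatAt F s x → IsFlatAt F t x →
    ∀ᶠ y in 𝓝 x, Q y (s y) (t y) = Q x (s x) (t x)
  /-- the Hodge filtration `H^{1,0} = F¹` -/
  H10 : ∀ x, Submodule ℂ (V x)
  /-- `H^{1,0}` is a holomorphic subbundle: it has holomorphic local frames -/
  H10_holomorphic : ∀ x, ∃ (r : ℕ) (f : Fin r → ∀ y, V y),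
    (∀ j, IsHolomorphicAt F E (f j) x) ∧
    ∀ᶠ y in 𝓝 x, LinearIndependent ℂ (fun j => f j y) ∧
      Submodule.span ℂ (Set.range fun j => f j y) = H10 y
  /-- Hodge decomposition `H¹_ℂ = H^{1,0} ⊕ H^{0,1}`, where `H^{0,1}` is conjugate to `H^{1,0}` -/
  isCompl : ∀ x, IsCompl (H10 x) ((H10 x).map (conj x))
  /-- first Riemann bilinear relation -/
  Q_H10 : ∀ x, ∀ u ∈ H10 x, ∀ v ∈ H10 x, Q x u v = 0
  /-- second Riemann bilinear relation -/
  Q_pos : ∀ x, ∀ u ∈ H10 x, u ≠ 0 → 0 < (I * Q x u (conj x u)).re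

namespace PolarizedVHS

variable {B : Type*} [TopologicalSpace B]
  {E : Type*} [NormedAddCommGroup E] [NormedSpace ℂ E] [ChartedSpace E B]
  {F : Type*} [NormedAddCommGroup F] [NormedSpace ℂ F]
  {V : B → Type*} [∀ x, AddCommGroup (V x)] [∀ x, Module ℂ (V x)] [∀ x, TopologicalSpace (V x)]
  [TopologicalSpace (TotalSpace F V)] [FiberBundle F V] [VectorBundle ℂ F V]
  (D : PolarizedVHS E F V)

/-- The fiber of `H¹_ℝ`. -/
def realFiber (x : B) : Submodule ℝ (V x) where
  carrier := {v | D.conj x v = v}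
  add_mem' {a b} ha hb := by
    simp only [Set.mem_ofPred_eq] at *
    rw [map_add, ha, hb]
  zero_mem' := by simp
  smul_mem' a v hv := by
    simp only [Set.mem_ofPred_eq] at *
    rw [← Complex.coe_smul, LinearMap.map_smulₛₗ, hv, Complex.conj_ofReal]

/-- `H^{0,1}`, the complex conjugate of `H^{1,0}`. -/
def H01 (x : B) : Submodule ℂ (V x) := (D.H10 x).map (D.conj x)

theorem isCompl_H01 (x : B) : IsCompl (D.H10 x) (D.H01 x) := D.isCompl x

/-- The projection of `H¹_ℂ` to `H^{1,0}` along `H^{0,1}`. -/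
def proj10 (x : B) : V x →ₗ[ℂ] V x := (D.H10 x).projection (D.H01 x) (D.isCompl_H01 x)

/-- The projection of `H¹_ℂ` to `H^{0,1}` along `H^{1,0}`. -/
def proj01 (x : B) : V x →ₗ[ℂ] V x := (D.H01 x).projection (D.H10 x) (D.isCompl_H01 x).symm

/-- The Weil operator: `i` on `H^{1,0}` and `-i` on `H^{0,1}`. -/
def weil (x : B) : V x →ₗ[ℂ] V x := I • D.proj10 x - I • D.proj01 x

/-- The positive definite Hodge metric `⟨u, v⟩ = Q(C u, v̄)`, with `C` the Weil operator. -/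
def hodge (x : B) (u v : V x) : ℂ := D.Q x (D.weil x u) (D.conj x v)

theorem exists_decomp (x : B) (u : V x) :
    ∃ a ∈ D.H10 x, ∃ b ∈ D.H10 x, u = a + D.conj x b := by
  have h : u ∈ D.H10 x ⊔ (D.H10 x).map (D.conj x) := by
    rw [(D.isCompl x).sup_eq_top]; trivial
  obtain ⟨a, ha, c, hc, rfl⟩ := Submodule.mem_sup.1 h
  obtain ⟨b, hb, rfl⟩ := hc
  exact ⟨a, ha, b, hb, rfl⟩

theorem proj10_apply (x : B) {a b : V x} (ha : a ∈ D.H10 x) (hb : b ∈ D.H10 x) :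
    D.proj10 x (a + D.conj x b) = a := by
  have h : D.conj x b ∈ D.H01 x := ⟨b, hb, rfl⟩
  rw [map_add, proj10, Submodule.projection_apply_of_mem_left _ ha,
    Submodule.projection_apply_of_mem_right _ h, add_zero]

theorem proj01_apply (x : B) {a b : V x} (ha : a ∈ D.H10 x) (hb : b ∈ D.H10 x) :
    D.proj01 x (a + D.conj x b) = D.conj x b := by
  have h : D.conj x b ∈ D.H01 x := ⟨b, hb, rfl⟩
  rw [map_add, proj01, Submodule.projection_apply_of_mem_left _ h,
    Submodule.projection_apply_of_mem_right _ ha, zero_add]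

theorem Q_swap (x : B) (u v : V x) : D.Q x u v = - D.Q x v u := by
  have h := D.Q_self x (u + v)
  simp only [map_add, LinearMap.add_apply, D.Q_self, zero_add, add_zero] at h
  linear_combination h

theorem hodge_apply (x : B) {a b c d : V x} (ha : a ∈ D.H10 x) (hb : b ∈ D.H10 x)
    (hc : c ∈ D.H10 x) (hd : d ∈ D.H10 x) :
    D.hodge x (a + D.conj x b) (c + D.conj x d) =
      I * D.Q x a (D.conj x c) + I * D.Q x d (D.conj x b) := by
  have h1 : D.Q x (D.conj x b) (D.conj x c) = 0 := by rw [D.Q_conj, D.Q_H10 x b hb c hc, map_zero]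
  have h2 := D.Q_swap x (D.conj x b) d
  rw [hodge, weil, LinearMap.sub_apply, LinearMap.smul_apply, LinearMap.smul_apply,
    D.proj10_apply x ha hb, D.proj01_apply x ha hb]
  simp only [map_add, map_sub, map_smul, D.conj_conj, LinearMap.smul_apply,
    LinearMap.sub_apply, smul_eq_mul, D.Q_H10 x a ha d hd, h1, h2]
  ring

/-- The Hodge metric as a positive definite Hermitian form (conjugate linear in the first
variable, as Mathlib's inner products are). -/
@[reducible] def hodgeCore (x : B) : InnerProductSpace.Core ℂ (V x) where
  inner u v := D.hodge x v u
  conj_inner_symm u v := by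
    obtain ⟨a, ha, b, hb, rfl⟩ := D.exists_decomp x u
    obtain ⟨c, hc, d, hd, rfl⟩ := D.exists_decomp x v
    rw [D.hodge_apply x ha hb hc hd, D.hodge_apply x hc hd ha hb]
    simp only [map_add, map_mul, ← D.Q_conj, D.conj_conj, Complex.conj_I]
    rw [D.Q_swap x (D.conj x a) c, D.Q_swap x (D.conj x d) b]
    ring
  re_inner_nonneg u := by
    obtain ⟨a, ha, b, hb, rfl⟩ := D.exists_decomp x u
    rw [D.hodge_apply x ha hb ha hb, map_add]
    have key : ∀ w ∈ D.H10 x, 0 ≤ (I * D.Q x w (D.conj x w)).re := fun w hw => by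
      rcases eq_or_ne w 0 with rfl | h
      · simp
      · exact (D.Q_pos x w hw h).le
    exact add_nonneg (key a ha) (key b hb)
  add_left u v w := by simp [hodge]
  smul_left u v r := by simp [hodge]
  definite u hu := by
    obtain ⟨a, ha, b, hb, rfl⟩ := D.exists_decomp x u
    change D.hodge x _ _ = 0 at hu
    rw [D.hodge_apply x ha hb ha hb] at hu
    have hre := congrArg Complex.re hu
    rw [Complex.add_re, Complex.zero_re] at hre
    have key : ∀ w ∈ D.H10 x, 0 ≤ (I * D.Q x w (D.conj x w)).re := fun w hw => by
      rcases eq_or_ne w 0 with rfl | h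
      · simp
      · exact (D.Q_pos x w hw h).le
    have ha0 : a = 0 := by
      by_contra h
      have := D.Q_pos x a ha h
      have := key b hb
      linarith
    have hb0 : b = 0 := by
      by_contra h
      have := D.Q_pos x b hb h
      have := key a ha
      linarith
    simp [ha0, hb0]

/-- The Hodge inner product on `H¹_ℝ` (the Hodge metric is real there). -/
def hodgeReal (x : B) : D.realFiber x →ₗ[ℝ] D.realFiber x →ₗ[ℝ] ℝ :=
  LinearMap.mk₂ ℝ (fun a b => (D.hodge x a b).re)
    (fun a b c => by simp [hodge])
    (fun r a b => by
      simp only [hodge, Submodule.coe_smul, ← Complex.coe_smul, map_smul, LinearMap.smul_apply,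
        smul_eq_mul, Complex.re_ofReal_mul])
    (fun a b c => by simp [hodge])
    (fun r a b => by
      simp only [hodge, Submodule.coe_smul, ← Complex.coe_smul, LinearMap.map_smulₛₗ,
        smul_eq_mul, Complex.conj_ofReal, Complex.re_ofReal_mul, map_smul])

/-- The square of the Hodge norm on the exterior power `⋀ᵏ H¹_ℝ`, for the inner product induced by
the Hodge inner product on `H¹_ℝ`. -/
def wedgeNormSq (x : B) {k : ℕ} (w : ⋀[ℝ]^k (D.realFiber x)) : ℝ :=
  exteriorPower.pairingDual ℝ (D.realFiber x) k (exteriorPower.map k (D.hodgeReal x) w) w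

theorem wedgeNormSq_ιMulti (x : B) {k : ℕ} (a : Fin k → D.realFiber x) :
    D.wedgeNormSq x (exteriorPower.ιMulti ℝ k a) =
      Matrix.det (Matrix.of fun i j => (D.hodge x (a j) (a i)).re) := by
  simp only [wedgeNormSq, exteriorPower.map_apply_ιMulti, exteriorPower.pairingDual_ιMulti_ιMulti]
  rfl

/-- Holomorphic sections of `H^{0,1} = H¹_ℂ / H^{1,0}`: those which lift locally to holomorphic
sections of `H¹_ℂ`. -/
def IsHolomorphic01At (φ : ∀ y, V y) (x : B) : Prop :=
  ∃ s : ∀ y, V y, IsHolomorphicAt F E s x ∧ ∀ᶠ y in 𝓝 x, φ y = D.proj01 y (s y)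


variable (F V) in
theorem finiteDimensional_fiber [FiniteDimensional ℂ F] (x : B) : FiniteDimensional ℂ (V x) :=
  ((trivializationAt F V x).linearEquivAt ℂ x
    (FiberBundle.mem_baseSet_trivializationAt' x)).symm.finiteDimensional

/-- The projection of `H¹_ℂ` to `H^{1,0}`, read in a trivialization of `H¹_ℂ`. -/
def proj10In [FiniteDimensional ℂ F]
    (e : Trivialization F (TotalSpace.proj : TotalSpace F V → B)) [MemTrivializationAtlas e]
    (y : B) : F →L[ℂ] F :=
  LinearMap.toContinuousLinearMap (e.linearMapAt ℂ y ∘ₗ D.proj10 y ∘ₗ e.symmₗ ℂ y)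

/-- The second fundamental form `σ : H^{1,0} → Ω¹ ⊗ H^{0,1}`, evaluated on a tangent vector `u` and
extended by `0` on `H^{0,1}`: on `H^{1,0}` it is the `H^{0,1}`-component of the covariant derivative
of the projection to `H^{1,0}`.  By `proj01_gaussManin` below this is the second fundamental form in
the usual sense, `σ_u(s) = π^{0,1}(∇_u s)` for sections `s` of `H^{1,0}`. -/
def secondFundamentalForm [FiniteDimensional ℂ F] (x : B) (u : TangentSpace 𝓘(ℂ, E) x) :
    V x →ₗ[ℂ] V x :=
  let e := trivializationAt F V x
  let dP : F →L[ℂ] F := dirDeriv (D.proj10In e) x u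
  D.proj01 x ∘ₗ e.symmₗ ℂ x ∘ₗ dP.toLinearMap ∘ₗ e.linearMapAt ℂ x ∘ₗ D.proj10 x

section SecondFundamentalForm

theorem eventually_conj_eq [FiniteDimensional ℂ F] [IsFlatBundle F V]
    (e : Trivialization F (TotalSpace.proj : TotalSpace F V → B)) [MemTrivializationAtlas e]
    (x : B) (hx : x ∈ e.baseSet) :
    ∀ᶠ y in 𝓝 x, ∀ v : F, e.linearMapAt ℂ y (D.conj y (e.symmₗ ℂ y v)) =
      e.linearMapAt ℂ x (D.conj x (e.symmₗ ℂ x v)) := by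
  have key : ∀ v : F, ∀ᶠ y in 𝓝 x, e.linearMapAt ℂ y (D.conj y (e.symmₗ ℂ y v)) =
      e.linearMapAt ℂ x (D.conj x (e.symmₗ ℂ x v)) := by
    intro v
    have hflat : IsFlatAt F (fun y => e.symmₗ ℂ y v) x := by
      intro e' _ hx'
      filter_upwards [IsFlatBundle.eventually_coordChange_eq e e' x ⟨hx, hx'⟩,
        e.open_baseSet.mem_nhds hx, e'.open_baseSet.mem_nhds hx'] with y hy h1 h2
      have h := congrArg (fun L : F ≃L[ℂ] F => L v) hy
      simp only [Trivialization.coordChangeL_apply e e' ⟨h1, h2⟩,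
        Trivialization.coordChangeL_apply e e' ⟨hx, hx'⟩] at h
      rw [e.symmₗ_apply h1, e.symmₗ_apply hx]
      exact h
    filter_upwards [D.conj_flat _ x hflat e hx, e.open_baseSet.mem_nhds hx] with y hy h1
    rw [e.coe_linearMapAt_of_mem h1, e.coe_linearMapAt_of_mem hx]
    exact hy
  let β := Module.finBasis ℂ F
  have hall : ∀ᶠ y in 𝓝 x, ∀ i, e.linearMapAt ℂ y (D.conj y (e.symmₗ ℂ y (β i))) =
      e.linearMapAt ℂ x (D.conj x (e.symmₗ ℂ x (β i))) :=
    Filter.eventually_all.2 fun i => key (β i)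
  filter_upwards [hall] with y hy v
  rw [← β.sum_repr v]
  simp only [map_sum, map_smul, LinearMap.map_smulₛₗ, hy]

theorem mdifferentiableAt_proj10In [FiniteDimensional ℂ F] [IsFlatBundle F V]
    (e : Trivialization F (TotalSpace.proj : TotalSpace F V → B)) [MemTrivializationAtlas e]
    (x : B) (hx : x ∈ e.baseSet) :
    MDifferentiableAt 𝓘(ℝ, E) 𝓘(ℝ, F →L[ℂ] F) (D.proj10In e) x := by
  obtain ⟨r, f, hol, hframe⟩ := D.H10_holomorphic x
  let κ : F →ₛₗ[starRingEnd ℂ] F :=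
    (e.linearMapAt ℂ x).comp ((D.conj x).comp (e.symmₗ ℂ x))
  let J : ((Fin r → ℂ) × (Fin r → ℂ)) →L[ℂ] ((Fin r → ℂ) × (Fin r → ℂ)) :=
    (ContinuousLinearMap.inl ℂ _ _).comp (ContinuousLinearMap.fst ℂ _ _)
  let Φ : (Fin r → F) →ₗ[ℝ] (((Fin r → ℂ) × (Fin r → ℂ)) →L[ℂ] F) :=
    { toFun := fun g => LinearMap.toContinuousLinearMap
        (LinearMap.coprod (Fintype.linearCombination ℂ g)
          (Fintype.linearCombination ℂ fun j => κ (g j)))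
      map_add' := fun g g' => by
        ext p <;>
        simp [Fintype.linearCombination_apply, smul_add, Finset.sum_add_distrib]
      map_smul' := fun a g => by
        have hκ : ∀ w : F, κ (a • w) = a • κ w := fun w => by
          rw [← Complex.coe_smul, LinearMap.map_smulₛₗ, Complex.conj_ofReal, Complex.coe_smul]
        ext p <;>
        simp [Fintype.linearCombination_apply, hκ, Finset.smul_sum, smul_comm a] }
  let g : B → Fin r → F := fun y j => (e ⟨y, f j y⟩).2
  have hg : MDifferentiableAt 𝓘(ℝ, E) 𝓘(ℝ, Fin r → F) g x := by
    have h := fun j => (mdifferentiableAt_iff _ _).1 ((hol j e hx).mdifferentiableAt (by simp))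
    rw [mdifferentiableAt_iff]
    exact ⟨continuousAt_pi.2 fun j => (h j).1,
      differentiableWithinAt_pi.2 fun j => (h j).2.restrictScalars ℝ⟩
  have hΦ : Differentiable ℝ Φ := (LinearMap.toContinuousLinearMap Φ).differentiable
  have hM : MDifferentiableAt 𝓘(ℝ, E) 𝓘(ℝ, ((Fin r → ℂ) × (Fin r → ℂ)) →L[ℂ] F)
      (fun y => Φ (g y)) x := (hΦ (g x)).comp_mdifferentiableAt hg
  have hΦ_apply : ∀ᶠ y in 𝓝 x, ∀ p q, Φ (g y) (p, q) = e.linearMapAt ℂ y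
      (∑ j, p j • f j y + D.conj y (∑ j, starRingEnd ℂ (q j) • f j y)) := by
    filter_upwards [D.eventually_conj_eq e x hx, e.open_baseSet.mem_nhds hx] with y hy h1 p q
    have hκ : ∀ w : V y, κ (e.linearMapAt ℂ y w) = e.linearMapAt ℂ y (D.conj y w) := by
      intro w
      have := hy (e.linearMapAt ℂ y w)
      rw [e.symmₗ_linearMapAt h1] at this
      exact this.symm
    have hgy : ∀ j, g y j = e.linearMapAt ℂ y (f j y) := fun j => by
      rw [e.coe_linearMapAt_of_mem h1]
    simp [Φ, Fintype.linearCombination_apply, hgy, hκ]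
  have hmemH : ∀ᶠ y in 𝓝 x, ∀ p : Fin r → ℂ, ∑ j, p j • f j y ∈ D.H10 y := by
    filter_upwards [hframe] with y hy p
    rw [← hy.2]
    exact Submodule.sum_mem _ fun j _ => Submodule.smul_mem _ _ (Submodule.subset_span ⟨j, rfl⟩)
  have hcomm : ∀ᶠ y in 𝓝 x, (D.proj10In e y).comp (Φ (g y)) = (Φ (g y)).comp J := by
    filter_upwards [hΦ_apply, hmemH, e.open_baseSet.mem_nhds hx] with y hy hH h1
    refine ContinuousLinearMap.ext ?_
    rintro ⟨p, q⟩
    have h2 := hy p 0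
    simp only [Pi.zero_apply, map_zero, zero_smul, Finset.sum_const_zero, add_zero] at h2
    change e.linearMapAt ℂ y (D.proj10 y (e.symmₗ ℂ y (Φ (g y) (p, q)))) = Φ (g y) (p, 0)
    rw [hy p q, e.symmₗ_linearMapAt h1, D.proj10_apply y (hH p) (hH _), h2]
  have hx_apply := hΦ_apply.self_of_nhds
  have hx_mem := hmemH.self_of_nhds
  obtain ⟨hli, hspan⟩ := hframe.self_of_nhds
  have hcoef : ∀ p : Fin r → ℂ, ∑ j, p j • f j x = 0 → p = 0 := fun p hp =>
    funext fun j => Fintype.linearIndependent_iff.1 hli p hp j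
  have hbij : Function.Bijective (Φ (g x)) := by
    constructor
    · rw [injective_iff_map_eq_zero]
      rintro ⟨p, q⟩ hpq
      rw [hx_apply p q] at hpq
      have h0 := congrArg (e.symmₗ ℂ x) hpq
      rw [e.symmₗ_linearMapAt hx, map_zero] at h0
      have h1 := congrArg (D.proj10 x) h0
      have h2 := congrArg (D.proj01 x) h0
      rw [D.proj10_apply x (hx_mem _) (hx_mem _), map_zero] at h1
      rw [D.proj01_apply x (hx_mem _) (hx_mem _), map_zero] at h2
      have h3 := congrArg (D.conj x) h2
      rw [D.conj_conj, map_zero] at h3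
      have h4 := hcoef p h1
      have h5 := hcoef _ h3
      have h6 : q = 0 := funext fun j => by simpa using congrFun h5 j
      rw [h4, h6]; rfl
    · intro w
      obtain ⟨a, ha, b, hb, hab⟩ := D.exists_decomp x (e.symmₗ ℂ x w)
      rw [← hspan, Submodule.mem_span_range_iff_exists_fun] at ha hb
      obtain ⟨p, rfl⟩ := ha
      obtain ⟨q, rfl⟩ := hb
      refine ⟨(p, fun j => starRingEnd ℂ (q j)), ?_⟩
      rw [hx_apply]
      simp only [Complex.conj_conj]
      rw [← hab, e.linearMapAt_symmₗ hx]
  let ε : ((Fin r → ℂ) × (Fin r → ℂ)) ≃L[ℂ] F :=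
    (LinearEquiv.ofBijective (Φ (g x)).toLinearMap hbij).toContinuousLinearEquiv
  have hε : (ε : ((Fin r → ℂ) × (Fin r → ℂ)) →L[ℂ] F) = Φ (g x) := by
    exact ContinuousLinearMap.ext fun _ => rfl
  have hinv : DifferentiableAt ℝ (ContinuousLinearMap.inverse :
      (((Fin r → ℂ) × (Fin r → ℂ)) →L[ℂ] F) → _) (Φ (g x)) := by
    rw [← hε]
    exact ((contDiffAt_map_inverse (n := 1) ε).differentiableAt (by simp)).restrictScalars ℝ
  have hN : MDifferentiableAt 𝓘(ℝ, E) 𝓘(ℝ, F →L[ℂ] ((Fin r → ℂ) × (Fin r → ℂ)))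
      (fun y => ContinuousLinearMap.inverse (Φ (g y))) x :=
    hinv.comp_mdifferentiableAt (f := fun y => Φ (g y)) hM
  have hcomp : Differentiable ℝ
      (fun z : (((Fin r → ℂ) × (Fin r → ℂ)) →L[ℂ] F) × (F →L[ℂ] ((Fin r → ℂ) × (Fin r → ℂ))) =>
        (z.1.comp J).comp z.2) := by
    have h : Differentiable ℂ
      (fun z : (((Fin r → ℂ) × (Fin r → ℂ)) →L[ℂ] F) × (F →L[ℂ] ((Fin r → ℂ) × (Fin r → ℂ))) =>
        (z.1.comp J).comp z.2) := by fun_prop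
    exact h.restrictScalars ℝ
  have hfinal : MDifferentiableAt 𝓘(ℝ, E) 𝓘(ℝ, F →L[ℂ] F)
      (fun y => ((Φ (g y)).comp J).comp (ContinuousLinearMap.inverse (Φ (g y)))) x :=
    (hcomp _).comp_mdifferentiableAt (f := fun y => (Φ (g y), ContinuousLinearMap.inverse (Φ (g y))))
      (hM.prodMk_space hN)
  refine hfinal.congr_of_eventuallyEq ?_
  have hnear : ∀ᶠ y in 𝓝 x, Φ (g y) ∈
      Set.range ((↑) : (((Fin r → ℂ) × (Fin r → ℂ)) ≃L[ℂ] F) → _) := by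
    have h := ContinuousLinearEquiv.nhds ε
    rw [hε] at h
    exact hM.continuousAt.eventually_mem h
  filter_upwards [hnear, hcomm] with y ⟨η, hη⟩ hy
  rw [← hy, ← hη, ContinuousLinearMap.inverse_equiv]
  ext1 w
  simp

/-- If `s` is a differentiable local section of `H^{1,0}`, then `π^{0,1}(∇_u s) = σ_u(s)`. -/
theorem proj01_gaussManin [FiniteDimensional ℂ F] [IsFlatBundle F V] (s : ∀ y, V y) (x : B)
    (hs : MDifferentiableAt 𝓘(ℝ, E) 𝓘(ℝ, F) (fun y => (trivializationAt F V x ⟨y, s y⟩).2) x)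
    (hmem : ∀ᶠ y in 𝓝 x, s y ∈ D.H10 y) (u : TangentSpace 𝓘(ℂ, E) x) :
    D.proj01 x (gaussManin F E s x u) = D.secondFundamentalForm x u (s x) := by
  set e := trivializationAt F V x with he
  have hx : x ∈ e.baseSet := FiberBundle.mem_baseSet_trivializationAt' x
  set S : B → F := fun y => (e ⟨y, s y⟩).2 with hS
  have hP := D.mdifferentiableAt_proj10In e x hx
  have hSP : S =ᶠ[𝓝 x] fun y => D.proj10In e y (S y) := by
    filter_upwards [hmem, e.open_baseSet.mem_nhds hx] with y hy h1
    have h2 : S y = e.linearMapAt ℂ y (s y) := by rw [e.coe_linearMapAt_of_mem h1]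
    change S y = e.linearMapAt ℂ y (D.proj10 y (e.symmₗ ℂ y (S y)))
    rw [h2, e.symmₗ_linearMapAt h1]
    have h3 := D.proj10_apply y hy (D.H10 y).zero_mem
    rw [map_zero, add_zero] at h3
    rw [h3]
  let ev : (F →L[ℂ] F) × F → F := fun z => z.1 z.2
  let restr : (F →L[ℂ] F) →L[ℝ] (F →L[ℝ] F) := ContinuousLinearMap.restrictScalarsL ℂ F F ℝ ℝ
  have hev : ∀ z w, (fderiv ℝ ev z) w = z.1 w.2 + w.1 z.2 ∧ DifferentiableAt ℝ ev z := by
    intro z w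
    have h : HasFDerivAt ev _ z :=
      (restr.hasFDerivAt.comp z hasFDerivAt_fst).clm_apply hasFDerivAt_snd
    refine ⟨?_, h.differentiableAt⟩
    rw [h.fderiv]
    rfl
  have hd : mfderiv 𝓘(ℝ, E) 𝓘(ℝ, F) S x = _ := hSP.mfderiv_eq
  have hpair : HasMFDerivAt 𝓘(ℝ, E) 𝓘(ℝ, (F →L[ℂ] F) × F) (fun y => (D.proj10In e y, S y)) x
      ((mfderiv 𝓘(ℝ, E) 𝓘(ℝ, F →L[ℂ] F) (D.proj10In e) x).prod
        (mfderiv 𝓘(ℝ, E) 𝓘(ℝ, F) S x)) :=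
    ⟨hP.hasMFDerivAt.1.prodMk hs.hasMFDerivAt.1, hP.hasMFDerivAt.2.prodMk hs.hasMFDerivAt.2⟩
  have hcomp : HasMFDerivAt 𝓘(ℝ, E) 𝓘(ℝ, F) (fun y => D.proj10In e y (S y)) x _ :=
    (hev (D.proj10In e x, S x) 0).2.hasFDerivAt.hasMFDerivAt.comp x hpair
  rw [hcomp.mfderiv] at hd
  have hdu : dirDeriv S x u =
      D.proj10In e x (dirDeriv S x u) +
        dirDeriv (D.proj10In e) x u (S x) :=
    (congrArg (fun L : E →L[ℝ] F => L u) hd).trans (hev (D.proj10In e x, S x) _).1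
  have hsx : D.proj10 x (s x) = s x := by
    have h3 := D.proj10_apply x hmem.self_of_nhds (D.H10 x).zero_mem
    rwa [map_zero, add_zero] at h3
  have hSx : e.linearMapAt ℂ x (s x) = S x := by rw [e.coe_linearMapAt_of_mem hx]
  have hkill : ∀ w : F, D.proj01 x (e.symmₗ ℂ x (D.proj10In e x w)) = 0 := by
    intro w
    change D.proj01 x (e.symmₗ ℂ x (e.linearMapAt ℂ x (D.proj10 x (e.symmₗ ℂ x w)))) = 0
    rw [e.symmₗ_linearMapAt hx]
    obtain ⟨a, ha, b, hb, hab⟩ := D.exists_decomp x (e.symmₗ ℂ x w)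
    rw [hab, D.proj10_apply x ha hb]
    have h3 := D.proj01_apply x ha (D.H10 x).zero_mem
    rwa [map_zero, add_zero] at h3
  have hgm : gaussManin F E s x u =
      e.symmₗ ℂ x (dirDeriv S x u) := by
    rw [e.symmₗ_apply hx]
    rfl
  have hσ : D.secondFundamentalForm x u (s x) = D.proj01 x (e.symmₗ ℂ x
      (dirDeriv (D.proj10In e) x u
        (e.linearMapAt ℂ x (D.proj10 x (s x))))) := rfl
  rw [hgm, hσ, hdu, map_add, map_add, hkill, zero_add, hsx, hSx]

end SecondFundamentalForm

/-- For a subspace `C` of `H^{0,1}`, its Hodge-orthogonal complement inside `H^{0,1}`. -/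
def perp01 (x : B) (C : Submodule ℂ (V x)) : Submodule ℂ (V x) :=
  HermitianLinearAlgebra.orthogonal (D.hodgeCore x) C ⊓ D.H01 x

/-- The adjoint of an endomorphism of the fiber of `H¹_ℂ` for the Hodge metric. -/
def adjoint [FiniteDimensional ℂ F] (x : B) (T : V x →ₗ[ℂ] V x) : V x →ₗ[ℂ] V x :=
  haveI := finiteDimensional_fiber F V x
  HermitianLinearAlgebra.adjoint (D.hodgeCore x) T

/-- The orthogonal projection onto a subspace of the fiber of `H¹_ℂ` for the Hodge metric. -/
def orthProj [FiniteDimensional ℂ F] (x : B) (K : Submodule ℂ (V x)) : V x →ₗ[ℂ] V x :=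
  haveI := finiteDimensional_fiber F V x
  HermitianLinearAlgebra.orthogonalProjection (D.hodgeCore x) K

end PolarizedVHS

end

/-! In a flat trivialization and a holomorphic chart, the variation becomes a family `p` of
projections of one fixed vector space, onto `H^{1,0}` along `H^{0,1}`, with constant conjugation and
polarization (`IsHodgeFamily`). Holomorphy of the image gives `∂̄p · p = 0`. Conjugation exchanges
`p` and `1 - p`, which gives `p · ∂p = 0`. So `∂p` is `σ` extended by zero, skewness with respect to
`Q` shows that `-∂̄p` is `σ†`, and differentiating the relations once more yields `∂∂̄p = ∂p ∂̄p -
∂̄p ∂p` (`delAt_delbarAt_idempotent`).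

Because the `c_i` are real and isotropic, `⟨c_i, c_j⟩ = 2i Q(p c_i, c_j)` (`hodge_of_Q_eq_zero`).
Hence the squared norm is `det G` with `G = Λ p J`, where `J` sends the standard basis of `ℂᵏ` to
the `c_i` and `Λ` has components `2i Q(·, c_j)`. In the flat trivialization `J` and `Λ` are
constant, so only `p` varies, and Jacobi's formula gives `∂∂̄ log det G = tr(G⁻¹ ∂∂̄G) - tr(G⁻¹ ∂G
G⁻¹ ∂̄G)`.

The same `G⁻¹` describes the orthogonal projections: `p - p J G⁻¹ Λ p` onto the conjugate of `C^⊥`,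
and `(1-p) + (1-p) J G⁻¹ Λ (1-p)` onto `C^⊥`. The signs differ because isotropy means `Λ J = 0`, so
that `Λ (1-p) J = -G`; this relation also gives the independence of the `φ_i`. Expanding the
right-hand side and using cyclicity of the trace (`trace_projection_identity`) finishes the proof.
The identity already holds for each ordered pair of tangent vectors, before antisymmetrization. -/

noncomputable section

/-! ### The operators `∂`, `∂̄` on vector-valued functions -/

section VectorDolbeault

variable {E : Type*} [NormedAddCommGroup E] [NormedSpace ℂ E]
  {G G' : Type*} [NormedAddCommGroup G] [NormedSpace ℂ G] [NormedAddCommGroup G'] [NormedSpace ℂ G']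
  {A : Type*} [NormedRing A] [NormedAlgebra ℂ A]

/-- The `(1,0)`-part of the differential of a vector-valued function. -/
def delAt (g : E → G) (z u : E) : G :=
  (1 / 2 : ℂ) • (fderiv ℝ g z u - I • fderiv ℝ g z (I • u))

/-- The `(0,1)`-part of the differential of a vector-valued function. -/
def delbarAt (g : E → G) (z u : E) : G :=
  (1 / 2 : ℂ) • (fderiv ℝ g z u + I • fderiv ℝ g z (I • u))

theorem delAt_add_delbarAt (g : E → G) (z u : E) :
    delAt g z u + delbarAt g z u = fderiv ℝ g z u := by
  rw [delAt, delbarAt]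
  module

theorem delAt_congr {g g' : E → G} {z : E} (h : g =ᶠ[𝓝 z] g') (u : E) :
    delAt g z u = delAt g' z u := by
  rw [delAt, delAt, h.fderiv_eq]

theorem delbarAt_congr {g g' : E → G} {z : E} (h : g =ᶠ[𝓝 z] g') (u : E) :
    delbarAt g z u = delbarAt g' z u := by
  rw [delbarAt, delbarAt, h.fderiv_eq]

theorem delAt_zero (z u : E) : delAt (fun _ => (0 : G)) z u = 0 := by
  simp [delAt]

theorem delAt_clm (L : G →L[ℂ] G') {g : E → G} {z : E} (hg : DifferentiableAt ℝ g z) (u : E) :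
    delAt (fun y => L (g y)) z u = L (delAt g z u) := by
  have h : HasFDerivAt (fun y => L (g y)) _ z :=
    (L.restrictScalars ℝ).hasFDerivAt.comp z hg.hasFDerivAt
  simp [delAt, h.fderiv]

theorem delbarAt_clm (L : G →L[ℂ] G') {g : E → G} {z : E} (hg : DifferentiableAt ℝ g z) (u : E) :
    delbarAt (fun y => L (g y)) z u = L (delbarAt g z u) := by
  have h : HasFDerivAt (fun y => L (g y)) _ z :=
    (L.restrictScalars ℝ).hasFDerivAt.comp z hg.hasFDerivAt
  simp [delbarAt, h.fderiv]

theorem delAt_mul {a b : E → A} {z : E} (ha : DifferentiableAt ℝ a z)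
    (hb : DifferentiableAt ℝ b z) (u : E) :
    delAt (fun y => a y * b y) z u = delAt a z u * b z + a z * delAt b z u := by
  have h : HasFDerivAt (fun y => a y * b y) _ z := ha.hasFDerivAt.mul' hb.hasFDerivAt
  simp only [delAt, h.fderiv, add_apply, smul_apply,
    smul_eq_mul, MulOpposite.smul_eq_mul_unop, MulOpposite.unop_op, smul_mul_assoc, mul_smul_comm,
    sub_mul, mul_sub]
  module

theorem delbarAt_mul {a b : E → A} {z : E} (ha : DifferentiableAt ℝ a z)
    (hb : DifferentiableAt ℝ b z) (u : E) :
    delbarAt (fun y => a y * b y) z u = delbarAt a z u * b z + a z * delbarAt b z u := by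
  have h : HasFDerivAt (fun y => a y * b y) _ z := ha.hasFDerivAt.mul' hb.hasFDerivAt
  simp only [delbarAt, h.fderiv, add_apply, smul_apply,
    smul_eq_mul, MulOpposite.smul_eq_mul_unop, MulOpposite.unop_op, smul_mul_assoc, mul_smul_comm,
    add_mul, mul_add]
  module

theorem delAt_ringInverse [CompleteSpace A] {a : E → A} {z : E} (ha : DifferentiableAt ℝ a z)
    (hu : IsUnit (a z)) (u : E) :
    delAt (fun y => Ring.inverse (a y)) z u =
      -(Ring.inverse (a z) * delAt a z u * Ring.inverse (a z)) := by
  obtain ⟨w, hw⟩ := hu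
  have h0 := hasFDerivAt_ringInverse (𝕜 := ℝ) w
  rw [hw] at h0
  have h : HasFDerivAt (fun y => Ring.inverse (a y)) _ z := h0.comp z ha.hasFDerivAt
  rw [← hw, Ring.inverse_unit]
  simp only [delAt, h.fderiv, ContinuousLinearMap.comp_apply, neg_apply,
    ContinuousLinearMap.mulLeftRight_apply, mul_smul_comm, smul_mul_assoc, sub_mul, mul_sub]
  module

theorem differentiableAt_delAt {g : E → G} {z : E} (hg : ContDiffAt ℝ 2 g z) (v : E) :
    DifferentiableAt ℝ (fun y => delAt g y v) z := by
  have h : DifferentiableAt ℝ (fderiv ℝ g) z :=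
    (hg.fderiv_right (m := 1) (by norm_num)).differentiableAt one_ne_zero
  unfold delAt
  fun_prop

theorem differentiableAt_delbarAt {g : E → G} {z : E} (hg : ContDiffAt ℝ 2 g z) (v : E) :
    DifferentiableAt ℝ (fun y => delbarAt g y v) z := by
  have h : DifferentiableAt ℝ (fderiv ℝ g) z :=
    (hg.fderiv_right (m := 1) (by norm_num)).differentiableAt one_ne_zero
  unfold delbarAt
  fun_prop

/-- Both operators are constant-coefficient combinations of real directional derivatives, so this is
the symmetry of the second real derivative. -/
theorem delAt_delbarAt_comm {g : E → G} {z : E} (hg : ContDiffAt ℝ 2 g z) (u v : E) :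
    delAt (fun y => delbarAt g y v) z u = delbarAt (fun y => delAt g y u) z v := by
  have h : DifferentiableAt ℝ (fderiv ℝ g) z :=
    (hg.fderiv_right (m := 1) (by norm_num)).differentiableAt one_ne_zero
  have hsymm : ∀ a b, fderiv ℝ (fderiv ℝ g) z a b = fderiv ℝ (fderiv ℝ g) z b a := fun a b =>
    hg.isSymmSndFDerivAt (by simp) a b
  have hev : ∀ a : E, HasFDerivAt (fun y => fderiv ℝ g y a)
      ((ContinuousLinearMap.apply ℝ G a).comp (fderiv ℝ (fderiv ℝ g) z)) z := fun a =>
    (ContinuousLinearMap.apply ℝ G a).hasFDerivAt.comp z h.hasFDerivAt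
  have h1 : HasFDerivAt (fun y => delbarAt g y v) _ z :=
    ((hev v).add ((hev (I • v)).const_smul I)).const_smul (1 / 2 : ℂ)
  have h2 : HasFDerivAt (fun y => delAt g y u) _ z :=
    ((hev u).sub ((hev (I • u)).const_smul I)).const_smul (1 / 2 : ℂ)
  rw [delAt, delbarAt, h1.fderiv, h2.fderiv]
  simp only [add_apply, sub_apply,
    smul_apply, ContinuousLinearMap.comp_apply,
    ContinuousLinearMap.apply_apply, hsymm u, hsymm (I • u)]
  module

/-- For a family of idempotents with holomorphic image and antiholomorphic kernel,
`∂∂̄p = ∂p ∂̄p - ∂̄p ∂p`. -/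
theorem delAt_delbarAt_idempotent {p : E → A} {z : E} (hp : ContDiffAt ℝ 2 p z)
    (hidem : ∀ᶠ y in 𝓝 z, p y * p y = p y)
    (hbar : ∀ᶠ y in 𝓝 z, ∀ u, delbarAt p y u * p y = 0)
    (hdel : ∀ᶠ y in 𝓝 z, ∀ u, p y * delAt p y u = 0) (u v : E) :
    delAt (fun y => delbarAt p y v) z u =
      delAt p z u * delbarAt p z v - delbarAt p z v * delAt p z u := by
  have hd : ∀ᶠ y in 𝓝 z, DifferentiableAt ℝ p y := by
    filter_upwards [hp.eventually (by simp)] with y hy using hy.differentiableAt two_ne_zero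
  have hdz := hd.self_of_nhds
  -- Apply `∂̄` to `p² = p` and drop the term `∂̄p · p`, which vanishes.
  have hbar2 : (fun y => delbarAt p y v) =ᶠ[𝓝 z] fun y => p y * delbarAt p y v := by
    filter_upwards [hidem.eventually_nhds, hbar, hd] with y h1 h2 h3
    have h4 := delbarAt_congr (z := y) h1 v
    rwa [delbarAt_mul h3 h3, h2, zero_add, eq_comm] at h4
  have hdel2 : (fun y => delAt p y u) =ᶠ[𝓝 z] fun y => delAt p y u * p y := by
    filter_upwards [hidem.eventually_nhds, hdel, hd] with y h1 h2 h3
    have h4 := delAt_congr (z := y) h1 u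
    rwa [delAt_mul h3 h3, h2, add_zero, eq_comm] at h4
  have db := differentiableAt_delbarAt hp v
  have dd := differentiableAt_delAt hp u
  set s := delAt p z u
  set t := delbarAt p z v with ht
  set X := delAt (fun y => delbarAt p y v) z u with hX
  have e1 : X = s * t + p z * X := by
    rw [hX, ht, ← delAt_mul hdz db]
    exact delAt_congr hbar2 u
  have e2 : X * p z + t * s = 0 := by
    rw [hX, ht, ← delAt_mul db hdz, ← delAt_zero z u]
    exact delAt_congr (hbar.mono fun y hy => hy v) u
  have e3 : X = X * p z + s * t := by
    -- After exchanging the two derivatives, `X` is `∂̄` of `∂p = ∂p · p`.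
    rw [hX, delAt_delbarAt_comm hp, ht, ← delbarAt_mul dd hdz]
    exact delbarAt_congr hdel2 v
  have h : X * p z = - (t * s) := eq_neg_of_add_eq_zero_left e2
  rw [e3, h]
  abel

end VectorDolbeault

/-! ### The logarithm of a determinant -/

section LogDet

variable {K : Type*} [NormedAddCommGroup K] [NormedSpace ℂ K] [FiniteDimensional ℂ K]

/-- The trace as a continuous linear functional. -/
def traceCLM (K : Type*) [NormedAddCommGroup K] [NormedSpace ℂ K] [FiniteDimensional ℂ K] :
    (K →L[ℂ] K) →L[ℂ] ℂ :=
  LinearMap.toContinuousLinearMap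
    (LinearMap.trace ℂ K ∘ₗ (ContinuousLinearMap.coeLM ℂ : (K →L[ℂ] K) →ₗ[ℂ] K →ₗ[ℂ] K))

theorem traceCLM_apply (f : K →L[ℂ] K) : traceCLM K f = LinearMap.trace ℂ K f := rfl

theorem contDiff_det {n : WithTop ℕ∞} : ContDiff ℂ n (fun f : K →L[ℂ] K => f.det) := by
  let β := Module.finBasis ℂ K
  have h : (fun f : K →L[ℂ] K => f.det) = fun f : K →L[ℂ] K =>
      (Matrix.of fun i j => (LinearMap.toContinuousLinearMap (β.coord i)) (f (β j))).det := by
    funext f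
    rw [ContinuousLinearMap.det, ← LinearMap.det_toMatrix β]
    congr 1
    ext i j
    simp [LinearMap.toMatrix_apply]
  rw [h]
  simp only [Matrix.det_apply, Matrix.of_apply]
  fun_prop

/-- Jacobi's formula. Differentiability is known beforehand, since the determinant is a polynomial,
so it suffices to differentiate along the lines `f + t h = f (1 + t f⁻¹h)`, where `det (1 + t m) = 1
+ t tr m + O(t²)`. -/
theorem hasFDerivAt_det (f : (K →L[ℂ] K)ˣ) :
    HasFDerivAt (fun g : K →L[ℂ] K => g.det)
      ((f : K →L[ℂ] K).det • (traceCLM K ∘L ContinuousLinearMap.mul ℂ (K →L[ℂ] K) ↑f⁻¹))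
      (f : K →L[ℂ] K) := by
  have hd : DifferentiableAt ℂ (fun g : K →L[ℂ] K => g.det) (f : K →L[ℂ] K) :=
    (contDiff_det (n := 1)).contDiffAt.differentiableAt one_ne_zero
  suffices hL : (f : K →L[ℂ] K).det • (traceCLM K ∘L ContinuousLinearMap.mul ℂ (K →L[ℂ] K) ↑f⁻¹) =
      fderiv ℂ (fun g : K →L[ℂ] K => g.det) (f : K →L[ℂ] K) by
    rw [hL]; exact hd.hasFDerivAt
  refine ContinuousLinearMap.ext fun (h : K →L[ℂ] K) => ?_
  have hline : HasDerivAt (fun t : ℂ => (f : K →L[ℂ] K) + t • h) h 0 := by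
    simpa using ((hasDerivAt_id (0 : ℂ)).smul_const h).const_add (f : K →L[ℂ] K)
  have hd' : HasFDerivAt (fun g : K →L[ℂ] K => g.det) (fderiv ℂ (fun g : K →L[ℂ] K => g.det) f)
      ((f : K →L[ℂ] K) + (0 : ℂ) • h) := by
    simpa using hd.hasFDerivAt
  have h1 := hd'.comp_hasDerivAt (0 : ℂ) hline
  let β := Module.finBasis ℂ K
  let m := LinearMap.toMatrix β β ((↑f⁻¹ * h : K →L[ℂ] K) : K →ₗ[ℂ] K)
  have hfun : ((fun g : K →L[ℂ] K => g.det) ∘ fun t : ℂ => (f : K →L[ℂ] K) + t • h) =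
      fun t : ℂ => (f : K →L[ℂ] K).det * (1 + t • m).det := by
    funext t
    have e1 : (f : K →L[ℂ] K) + t • h = f * (1 + t • (↑f⁻¹ * h)) := by
      rw [mul_add, mul_one, mul_smul_comm, Units.mul_inv_cancel_left]
    have e2 : (1 + t • m) = LinearMap.toMatrix β β
        ((1 + t • (↑f⁻¹ * h) : K →L[ℂ] K) : K →ₗ[ℂ] K) := by
      have : ((1 + t • (↑f⁻¹ * h) : K →L[ℂ] K) : K →ₗ[ℂ] K) =
        1 + t • ((↑f⁻¹ * h : K →L[ℂ] K) : K →ₗ[ℂ] K) := rfl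
      rw [this, map_add, map_smul, LinearMap.toMatrix_one]
    rw [Function.comp_apply, e1, e2, LinearMap.det_toMatrix]
    exact LinearMap.det_comp _ _
  have h2 : HasDerivAt (fun t : ℂ => (f : K →L[ℂ] K).det * (1 + t • m).det)
      ((f : K →L[ℂ] K).det * m.trace) 0 := by
    -- `P` collects the terms of degree at least two of `det (1 + X m)`, divided by `X²`.
    let P := (Matrix.det (1 + (Polynomial.X : Polynomial ℂ) • m.map Polynomial.C)).divX.divX
    have h3 := ((((hasDerivAt_id (0 : ℂ)).const_mul m.trace).const_add 1).add
      ((P.hasDerivAt 0).mul ((hasDerivAt_id (0 : ℂ)).pow 2))).const_mul (f : K →L[ℂ] K).det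
    have e3 : (fun t : ℂ => (f : K →L[ℂ] K).det * (1 + t • m).det) =
        fun t => (f : K →L[ℂ] K).det * (1 + m.trace * t + P.eval t * t ^ 2) := by
      funext t
      rw [Matrix.det_one_add_smul t m]
    rw [e3]
    simpa using! h3
  rw [hfun] at h1
  have h4 := h2.unique h1
  rw [← h4]
  simp only [smul_apply, ContinuousLinearMap.comp_apply,
    ContinuousLinearMap.mul_apply', smul_eq_mul, traceCLM_apply]
  rw [LinearMap.trace_eq_matrix_trace ℂ β]

variable {E : Type*} [NormedAddCommGroup E] [NormedSpace ℂ E]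

theorem isUnit_of_det_ne_zero {f : K →L[ℂ] K} (h : f.det ≠ 0) : IsUnit f := by
  have h1 : IsUnit (LinearMap.det (f : K →ₗ[ℂ] K)) := isUnit_iff_ne_zero.2 h
  exact ((LinearMap.isUnit_iff_isUnit_det _).2 h1).map (Module.End.toContinuousLinearMap K)

/-- Positivity of `N` places the determinant in the slit plane, where the complex logarithm is
holomorphic and agrees with the real one; then Jacobi's formula and the chain rule apply. -/
theorem delbarAt_log_det {G : E → K →L[ℂ] K} {N : E → ℝ} {z : E} (hG : DifferentiableAt ℝ G z)
    (hN : ∀ᶠ y in 𝓝 z, (N y : ℂ) = (G y).det) (hpos : ∀ᶠ y in 𝓝 z, 0 < N y) (v : E) :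
    delbarAt (fun y => ((Real.log (N y) : ℝ) : ℂ)) z v =
      traceCLM K (Ring.inverse (G z) * delbarAt G z v) := by
  have hz := hpos.self_of_nhds
  have hNz := hN.self_of_nhds
  have hne : (G z).det ≠ 0 := by
    rw [← hNz]; exact_mod_cast hz.ne'
  obtain ⟨w, hw⟩ := isUnit_of_det_ne_zero hne
  have hlog : (fun y => ((Real.log (N y) : ℝ) : ℂ)) =ᶠ[𝓝 z] fun y => Complex.log (G y).det := by
    filter_upwards [hN, hpos] with y h1 h2
    rw [Complex.ofReal_log h2.le, h1]
  have h0 := (hasFDerivAt_det w).restrictScalars ℝ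
  rw [hw] at h0
  have h1 : HasFDerivAt (fun y => (G y).det) _ z := h0.comp z hG.hasFDerivAt
  have h2 : HasFDerivAt (fun y => Complex.log (G y).det) _ z :=
    ((Complex.hasDerivAt_log (by
      rw [← hNz]; exact Complex.ofReal_mem_slitPlane.2 hz)).hasFDerivAt.restrictScalars ℝ).comp z h1
  rw [delbarAt_congr hlog, delbarAt, h2.fderiv, ← hw, Ring.inverse_unit]
  simp only [smul_apply, ContinuousLinearMap.comp_apply,
    ContinuousLinearMap.coe_restrictScalars', ContinuousLinearMap.mul_apply', hw, delbarAt,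
    ContinuousLinearMap.toSpanSingleton_apply,
    mul_smul_comm, map_smul, mul_add, map_add, smul_eq_mul]
  field_simp

/-- Leibniz rule for `tr(G⁻¹ ∂̄G)`; the second term comes from `∂(G⁻¹) = -G⁻¹ ∂G G⁻¹`. -/
theorem delAt_delbarAt_log_det {G : E → K →L[ℂ] K} {N : E → ℝ} {z : E} (hG : ContDiffAt ℝ 2 G z)
    (hN : ∀ᶠ y in 𝓝 z, (N y : ℂ) = (G y).det) (hpos : ∀ᶠ y in 𝓝 z, 0 < N y) (u v : E) :
    delAt (fun y => delbarAt (fun y => ((Real.log (N y) : ℝ) : ℂ)) y v) z u =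
      traceCLM K (Ring.inverse (G z) * delAt (fun y => delbarAt G y v) z u) -
      traceCLM K (Ring.inverse (G z) * delAt G z u * Ring.inverse (G z) * delbarAt G z v) := by
  have hd : ∀ᶠ y in 𝓝 z, DifferentiableAt ℝ G y := by
    filter_upwards [hG.eventually (by simp)] with y hy using hy.differentiableAt two_ne_zero
  have h1 : (fun y => delbarAt (fun y => ((Real.log (N y) : ℝ) : ℂ)) y v) =ᶠ[𝓝 z]
      fun y => traceCLM K (Ring.inverse (G y) * delbarAt G y v) := by
    filter_upwards [hd, hN.eventually_nhds, hpos.eventually_nhds] with y h1 h2 h3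
    exact delbarAt_log_det h1 h2 h3 v
  have hne : (G z).det ≠ 0 := by
    rw [← hN.self_of_nhds]; exact_mod_cast hpos.self_of_nhds.ne'
  have hu := isUnit_of_det_ne_zero hne
  have hinv : DifferentiableAt ℝ (fun y => Ring.inverse (G y)) z :=
    (differentiableAt_inverse hu).comp z hd.self_of_nhds
  have hb := differentiableAt_delbarAt hG v
  have hm : DifferentiableAt ℝ (fun y => Ring.inverse (G y) * delbarAt G y v) z := hinv.mul hb
  rw [delAt_congr h1, delAt_clm (traceCLM K) hm, delAt_mul hinv hb,
    delAt_ringInverse hd.self_of_nhds hu, map_add, neg_mul, map_neg]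
  abel

end LogDet

end

noncomputable section

/-! ### Families of weight one Hodge structures on a fixed vector space -/

section VectorDolbeault

variable {E : Type*} [NormedAddCommGroup E] [NormedSpace ℂ E]
  {F : Type*} [NormedAddCommGroup F] [NormedSpace ℂ F]
  {G : Type*} [NormedAddCommGroup G] [NormedSpace ℂ G]

theorem delbarAt_clm_apply {a : E → F →L[ℂ] G} {b : E → F} {z : E} (ha : DifferentiableAt ℝ a z)
    (hb : DifferentiableAt ℝ b z) (u : E) :
    delbarAt (fun y => a y (b y)) z u = delbarAt a z u (b z) + a z (delbarAt b z u) := by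
  let restr : (F →L[ℂ] G) →L[ℝ] (F →L[ℝ] G) := ContinuousLinearMap.restrictScalarsL ℂ F G ℝ ℝ
  have h : HasFDerivAt (fun y => a y (b y)) _ z :=
    (restr.hasFDerivAt.comp z ha.hasFDerivAt).clm_apply hb.hasFDerivAt
  have hr : ∀ (L : F →L[ℂ] G) (w : F), restr L w = L w := fun _ _ => rfl
  rw [delbarAt, h.fderiv]
  simp only [add_apply, ContinuousLinearMap.comp_apply, ContinuousLinearMap.flip_apply,
    Function.comp_apply, hr, delbarAt, smul_apply, map_add, map_smul]
  module

theorem delbarAt_eq_zero {g : E → G} {z : E} (hg : DifferentiableAt ℂ g z) (u : E) :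
    delbarAt g z u = 0 := by
  rw [delbarAt, hg.fderiv_restrictScalars ℝ]
  simp only [ContinuousLinearMap.coe_restrictScalars', map_smul, smul_smul, I_mul_I]
  module

/-- A family of weight one Hodge structures on a fixed complex vector space `F` with conjugation
`κ` and polarization `q`, given by the projections to the `(1,0)`-parts. -/
structure IsHodgeFamily (κ : F →ₛₗ[starRingEnd ℂ] F) (q : F →ₗ[ℂ] F →ₗ[ℂ] ℂ) (p : E → F →L[ℂ] F)
    (z₀ : E) : Prop where
  contDiffAt : ContDiffAt ℝ ω p z₀
  conj_conj : ∀ w, κ (κ w) = w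
  idem : ∀ᶠ z in 𝓝 z₀, p z * p z = p z
  conj_eq : ∀ᶠ z in 𝓝 z₀, ∀ w, κ (p z (κ w)) = w - p z w
  q_eq : ∀ᶠ z in 𝓝 z₀, ∀ v w, q (p z v) w = q v (w - p z w)
  holo : ∀ᶠ z in 𝓝 z₀, ∃ (r : ℕ) (g : Fin r → E → F), (∀ j, DifferentiableAt ℂ (g j) z) ∧
    (∀ᶠ y in 𝓝 z, ∀ j, p y (g j y) = g j y) ∧
    ∀ w, p z w ∈ Submodule.span ℂ (Set.range fun j => g j z)

namespace IsHodgeFamily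

variable {κ : F →ₛₗ[starRingEnd ℂ] F} {q : F →ₗ[ℂ] F →ₗ[ℂ] ℂ} {p : E → F →L[ℂ] F} {z₀ : E}
  (H : IsHodgeFamily κ q p z₀)
include H

theorem eventually_differentiableAt : ∀ᶠ z in 𝓝 z₀, DifferentiableAt ℝ p z := by
  filter_upwards [H.contDiffAt.eventually (by simp)] with y hy using hy.differentiableAt (by simp)

/-- For holomorphic sections `g_j` of the image, `∂̄` of `p g_j = g_j` leaves `(∂̄p) g_j = 0`, and
the `g_j` span the image of `p`. -/
theorem eventually_delbarAt_mul : ∀ᶠ z in 𝓝 z₀, ∀ u, delbarAt p z u * p z = 0 := by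
  filter_upwards [H.eventually_differentiableAt, H.holo] with z hz ⟨r, g, hg, hpg, hspan⟩ u
  have h0 : ∀ j, delbarAt p z u (g j z) = 0 := fun j => by
    have h1 := delbarAt_clm_apply hz ((hg j).restrictScalars ℝ) u
    rw [delbarAt_congr (hpg.mono fun y hy => hy j) u, delbarAt_eq_zero (hg j), map_zero,
      add_zero] at h1
    exact h1.symm
  ext w
  have h2 : Submodule.span ℂ (Set.range fun j => g j z) ≤
      LinearMap.ker (delbarAt p z u : F →L[ℂ] F).toLinearMap := by
    rw [Submodule.span_le]
    rintro _ ⟨j, rfl⟩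
    exact h0 j
  exact h2 (hspan w)

theorem eventually_mul_delbarAt : ∀ᶠ z in 𝓝 z₀, ∀ u, p z * delbarAt p z u = delbarAt p z u := by
  filter_upwards [H.eventually_differentiableAt, H.idem.eventually_nhds,
    H.eventually_delbarAt_mul] with z hz h1 h2 u
  have h4 := delbarAt_congr (z := z) h1 u
  rwa [delbarAt_mul hz hz, h2, zero_add] at h4

theorem eventually_conj_fderiv [FiniteDimensional ℂ F] :
    ∀ᶠ z in 𝓝 z₀, ∀ u w, κ (fderiv ℝ p z u (κ w)) = - fderiv ℝ p z u w := by
  filter_upwards [H.eventually_differentiableAt, H.conj_eq.eventually_nhds] with z hz h1 u w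
  let κR : F →ₗ[ℝ] F :=
    { toFun := κ
      map_add' := map_add κ
      map_smul' := fun a v => by
        rw [← Complex.coe_smul, LinearMap.map_smulₛₗ, Complex.conj_ofReal, Complex.coe_smul]
        rfl }
  let ev : F → (F →L[ℂ] F) →L[ℝ] F := fun w =>
    (ContinuousLinearMap.apply ℂ F w).restrictScalars ℝ
  have h2 : HasFDerivAt (fun y => κR.toContinuousLinearMap (ev (κ w) (p y))) _ z :=
    κR.toContinuousLinearMap.hasFDerivAt.comp z ((ev (κ w)).hasFDerivAt.comp z hz.hasFDerivAt)
  have h3 : HasFDerivAt (fun y => w - ev w (p y)) _ z :=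
    ((ev w).hasFDerivAt.comp z hz.hasFDerivAt).const_sub w
  have h4 : (fun y => κR.toContinuousLinearMap (ev (κ w) (p y))) =ᶠ[𝓝 z]
      fun y => w - ev w (p y) := h1.mono fun y hy => hy w
  have h5 := h2.unique (h3.congr_of_eventuallyEq h4)
  exact congrArg (fun L : E →L[ℝ] F => L u) h5

/-- The real derivative of `κ p κ = 1 - p` changes sign under conjugation, and antilinearity of `κ`
turns `I` into `-I`, which exchanges `∂̄` with `∂`. -/
theorem eventually_conj_delbarAt [FiniteDimensional ℂ F] :
    ∀ᶠ z in 𝓝 z₀, ∀ u w, κ (delbarAt p z u (κ w)) = - delAt p z u w := by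
  filter_upwards [H.eventually_conj_fderiv] with z hz u w
  have h2 : starRingEnd ℂ (1 / 2) = 1 / 2 := by rw [map_div₀, map_one, map_ofNat]
  simp only [delbarAt, delAt, smul_apply, add_apply, sub_apply, LinearMap.map_smulₛₗ, map_add, hz,
    h2, conj_I]
  module

/-- This is the conjugate of `p ∂̄p = ∂̄p`: the image of `∂̄p` lies in that of `p`, which `κ`
carries into the kernel of `p`. -/
theorem eventually_mul_delAt [FiniteDimensional ℂ F] :
    ∀ᶠ z in 𝓝 z₀, ∀ u, p z * delAt p z u = 0 := by
  filter_upwards [H.eventually_conj_delbarAt, H.eventually_mul_delbarAt, H.conj_eq]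
    with z h1 h2 h3 u
  ext w
  have h4 := h1 u w
  have h5 : p z (delbarAt p z u (κ w)) = delbarAt p z u (κ w) :=
    congrArg (fun L : F →L[ℂ] F => L (κ w)) (h2 u)
  have h6 := h3 (κ (delbarAt p z u (κ w)))
  rw [H.conj_conj, h5, eq_comm, sub_eq_self, h4, map_neg, neg_eq_zero] at h6
  exact h6

theorem eventually_delAt_mul [FiniteDimensional ℂ F] :
    ∀ᶠ z in 𝓝 z₀, ∀ u, delAt p z u * p z = delAt p z u := by
  filter_upwards [H.eventually_differentiableAt, H.idem.eventually_nhds,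
    H.eventually_mul_delAt] with z hz h1 h2 u
  have h4 := delAt_congr (z := z) h1 u
  rwa [delAt_mul hz hz, h2, add_zero] at h4

/-- Derivative of `q(p v, w) = q(v, (1 - p) w)`. This skewness is what later makes `-∂̄p` the Hodge
adjoint of `∂p`. -/
theorem q_fderiv [FiniteDimensional ℂ F] (u : E) (v w : F) :
    q (fderiv ℝ p z₀ u v) w = - q v (fderiv ℝ p z₀ u w) := by
  have hz := H.eventually_differentiableAt.self_of_nhds
  let l₁ : (F →L[ℂ] F) →L[ℝ] ℂ := ((q.flip w).toContinuousLinearMap.comp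
    (ContinuousLinearMap.apply ℂ F v)).restrictScalars ℝ
  let l₂ : (F →L[ℂ] F) →L[ℝ] ℂ := ((q v).toContinuousLinearMap.comp
    (ContinuousLinearMap.apply ℂ F w)).restrictScalars ℝ
  have h2 : HasFDerivAt (fun y => l₁ (p y)) _ z₀ := l₁.hasFDerivAt.comp z₀ hz.hasFDerivAt
  have h3 : HasFDerivAt (fun y => q v w - l₂ (p y)) _ z₀ :=
    (l₂.hasFDerivAt.comp z₀ hz.hasFDerivAt).const_sub (q v w)
  have h4 : (fun y => l₁ (p y)) =ᶠ[𝓝 z₀] fun y => q v w - l₂ (p y) :=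
    H.q_eq.mono fun y hy => (hy v w).trans (map_sub (q v) _ _)
  have h5 := h2.unique (h3.congr_of_eventuallyEq h4)
  exact congrArg (fun L : E →L[ℝ] ℂ => L u) h5

theorem q_delbarAt [FiniteDimensional ℂ F] (u : E) (v w : F) :
    q (delbarAt p z₀ u v) w = - q v (delbarAt p z₀ u w) := by
  simp only [delbarAt, smul_apply, add_apply, map_smul, map_add, LinearMap.smul_apply,
    LinearMap.add_apply, H.q_fderiv, smul_eq_mul]
  ring

theorem delAt_delbarAt [FiniteDimensional ℂ F] (u v : E) :
    delAt (fun y => delbarAt p y v) z₀ u =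
      delAt p z₀ u * delbarAt p z₀ v - delbarAt p z₀ v * delAt p z₀ u :=
  delAt_delbarAt_idempotent (H.contDiffAt.of_le (by simp)) H.idem H.eventually_delbarAt_mul
    H.eventually_mul_delAt u v

/-- `∂∂̄ log det (Λ p J)`, for a family of Hodge structures `p` and fixed linear maps `Λ`, `J`. -/
theorem delAt_delbarAt_log_det [FiniteDimensional ℂ F]
    {K : Type*} [NormedAddCommGroup K] [NormedSpace ℂ K] [FiniteDimensional ℂ K]
    (J : K →L[ℂ] F) (Λ : F →L[ℂ] K) {N : E → ℝ}
    (hN : ∀ᶠ y in 𝓝 z₀, (N y : ℂ) = (Λ ∘L p y ∘L J).det) (hpos : ∀ᶠ y in 𝓝 z₀, 0 < N y)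
    (u v : E) :
    delAt (fun y => delbarAt (fun y => ((Real.log (N y) : ℝ) : ℂ)) y v) z₀ u =
      traceCLM K (Ring.inverse (Λ ∘L p z₀ ∘L J) * (Λ ∘L (delAt p z₀ u * delbarAt p z₀ v -
        delbarAt p z₀ v * delAt p z₀ u) ∘L J)) -
      traceCLM K (Ring.inverse (Λ ∘L p z₀ ∘L J) * (Λ ∘L delAt p z₀ u ∘L J) *
        Ring.inverse (Λ ∘L p z₀ ∘L J) * (Λ ∘L delbarAt p z₀ v ∘L J)) := by
  -- `A ↦ Λ A J` is a fixed complex linear map, so it commutes with `∂` and `∂̄`.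
  let Ψ : (F →L[ℂ] F) →L[ℂ] (K →L[ℂ] K) :=
    (ContinuousLinearMap.compL ℂ K F K Λ).comp ((ContinuousLinearMap.compL ℂ K F F).flip J)
  have hp2 : ContDiffAt ℝ 2 p z₀ := H.contDiffAt.of_le (by simp)
  have hG : ContDiffAt ℝ 2 (fun y => Ψ (p y)) z₀ :=
    ((Ψ.restrictScalars ℝ).contDiff.contDiffAt).comp z₀ hp2
  have hd := H.eventually_differentiableAt
  have hdb : (fun y => delbarAt (fun y => Ψ (p y)) y v) =ᶠ[𝓝 z₀] fun y => Ψ (delbarAt p y v) := by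
    filter_upwards [hd] with y hy using delbarAt_clm Ψ hy v
  have h := _root_.delAt_delbarAt_log_det hG hN hpos u v
  rw [delAt_congr hdb, delAt_clm Ψ (differentiableAt_delbarAt hp2 v), H.delAt_delbarAt,
    delAt_clm Ψ hd.self_of_nhds, delbarAt_clm Ψ hd.self_of_nhds] at h
  exact h

end IsHodgeFamily

end VectorDolbeault

end

noncomputable section

/-! ### Derivatives and smoothness in the holomorphic chart -/

section Charts

variable {B : Type*} [TopologicalSpace B] {E : Type*} [NormedAddCommGroup E] [NormedSpace ℂ E]
  [ChartedSpace E B] {G : Type*} [NormedAddCommGroup G]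

theorem dirDeriv_eq_fderiv [NormedSpace ℝ G] {g : B → G} {x : B}
    (hg : MDifferentiableAt 𝓘(ℝ, E) 𝓘(ℝ, G) g x) (u : TangentSpace 𝓘(ℂ, E) x) :
    dirDeriv g x u = fderiv ℝ (fun z => g ((extChartAt 𝓘(ℂ, E) x).symm z))
      (extChartAt 𝓘(ℂ, E) x x) u := by
  simp only [dirDeriv, mfderiv, hg, writtenInExtChartAt, extChartAt_model_space_eq_id,
    PartialEquiv.refl_coe, Function.id_comp, modelWithCornersSelf_coe, Set.range_id,
    fderivWithin_univ]
  rfl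

theorem ContMDiffAt.contDiffAt_chart [NormedSpace ℂ G] {n : WithTop ℕ∞} {g : B → G} {x : B}
    (hg : ContMDiffAt 𝓘(ℂ, E) 𝓘(ℂ, G) n g x) :
    ContDiffAt ℂ n (fun z => g ((extChartAt 𝓘(ℂ, E) x).symm z)) (extChartAt 𝓘(ℂ, E) x x) := by
  have h := (contMDiffAt_iff.1 hg).2
  simp only [extChartAt_model_space_eq_id, PartialEquiv.refl_coe, Function.id_comp,
    modelWithCornersSelf_coe, Set.range_id, contDiffWithinAt_univ] at h
  exact h

/-- The real and complex models have the same charts, so real smoothness can be tested in the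
holomorphic chart. -/
theorem contMDiffAt_of_contDiffAt_chart [NormedSpace ℝ G] {n : WithTop ℕ∞} {g : B → G} {x : B}
    (hg : ContDiffAt ℝ n (fun z => g ((extChartAt 𝓘(ℂ, E) x).symm z)) (extChartAt 𝓘(ℂ, E) x x)) :
    ContMDiffAt 𝓘(ℝ, E) 𝓘(ℝ, G) n g x := by
  rw [contMDiffAt_iff]
  constructor
  · have h1 := hg.continuousAt.comp (continuousAt_extChartAt (I := 𝓘(ℂ, E)) x)
    refine h1.congr ?_
    filter_upwards [extChartAt_source_mem_nhds (I := 𝓘(ℂ, E)) x] with y hy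
    exact congrArg g ((extChartAt 𝓘(ℂ, E) x).left_inv hy)
  · simp only [extChartAt_model_space_eq_id, PartialEquiv.refl_coe, Function.id_comp,
      modelWithCornersSelf_coe, Set.range_id, contDiffWithinAt_univ]
    exact hg

theorem tendsto_extChartAt_symm (x : B) :
    Filter.Tendsto (extChartAt 𝓘(ℂ, E) x).symm (𝓝 (extChartAt 𝓘(ℂ, E) x x)) (𝓝 x) := by
  have h := continuousAt_extChartAt_symm (I := 𝓘(ℂ, E)) x
  rwa [ContinuousAt, extChartAt_to_inv] at h

end Charts

/-! ### Regularity of a projection given by a frame -/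

section Frames

variable {E : Type*} [NormedAddCommGroup E] [NormedSpace ℂ E]
  {F : Type*} [NormedAddCommGroup F] [NormedSpace ℂ F]

/-- The linear map `(p, q) ↦ ∑ pⱼ gⱼ + ∑ qⱼ κ(gⱼ)`, as a real-linear function of the frame `g`. -/
def frameMap (κ : F →ₛₗ[starRingEnd ℂ] F) (r : ℕ) :
    (Fin r → F) →ₗ[ℝ] (((Fin r → ℂ) × (Fin r → ℂ)) →L[ℂ] F) where
  toFun g := LinearMap.toContinuousLinearMap
    (LinearMap.coprod (Fintype.linearCombination ℂ g) (Fintype.linearCombination ℂ fun j => κ (g j)))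
  map_add' g g' := by
    ext p <;> simp [Fintype.linearCombination_apply, smul_add, Finset.sum_add_distrib]
  map_smul' a g := by
    have hκ : ∀ w : F, κ (a • w) = a • κ w := fun w => by
      rw [← Complex.coe_smul, LinearMap.map_smulₛₗ, Complex.conj_ofReal, Complex.coe_smul]
    ext p <;> simp [Fintype.linearCombination_apply, hκ, Finset.smul_sum, smul_comm a]

theorem frameMap_apply (κ : F →ₛₗ[starRingEnd ℂ] F) {r : ℕ} (g : Fin r → F) (a b : Fin r → ℂ) :
    frameMap κ r g (a, b) = ∑ j, a j • g j + ∑ j, b j • κ (g j) := by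
  simp [frameMap, Fintype.linearCombination_apply]

/-- The projections to the span of an analytic frame `g` along the span of `κ g` are analytic. -/
theorem contDiffAt_of_frame [FiniteDimensional ℂ F] (κ : F →ₛₗ[starRingEnd ℂ] F) {r : ℕ} {g : E → Fin r → F} {z₀ : E}
    {n : WithTop ℕ∞} (hg : ContDiffAt ℝ n g z₀) {p : E → F →L[ℂ] F}
    (hp : ∀ᶠ z in 𝓝 z₀, ∀ j, p z (g z j) = g z j ∧ p z (κ (g z j)) = 0)
    (hbij : Function.Bijective (frameMap κ r (g z₀))) : ContDiffAt ℝ n p z₀ := by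
  -- In frame coordinates the projection is `(a, b) ↦ (a, 0)`, so `p = Φ J Φ⁻¹` with `Φ` the frame
  -- map.
  let J : ((Fin r → ℂ) × (Fin r → ℂ)) →L[ℂ] ((Fin r → ℂ) × (Fin r → ℂ)) :=
    (ContinuousLinearMap.inl ℂ _ _).comp (ContinuousLinearMap.fst ℂ _ _)
  have hM : ContDiffAt ℝ n (fun z => frameMap κ r (g z)) z₀ :=
    ((frameMap κ r).toContinuousLinearMap.contDiff.contDiffAt).comp z₀ hg
  let ε : ((Fin r → ℂ) × (Fin r → ℂ)) ≃L[ℂ] F :=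
    (LinearEquiv.ofBijective (frameMap κ r (g z₀)).toLinearMap hbij).toContinuousLinearEquiv
  have hε : (ε : ((Fin r → ℂ) × (Fin r → ℂ)) →L[ℂ] F) = frameMap κ r (g z₀) :=
    ContinuousLinearMap.ext fun _ => rfl
  have hinv : ContDiffAt ℝ n (ContinuousLinearMap.inverse :
      (((Fin r → ℂ) × (Fin r → ℂ)) →L[ℂ] F) → _) (frameMap κ r (g z₀)) := by
    rw [← hε]
    exact (contDiffAt_map_inverse ε).restrict_scalars ℝ
  have hN : ContDiffAt ℝ n (fun z => ContinuousLinearMap.inverse (frameMap κ r (g z))) z₀ :=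
    ContDiffAt.comp (f := fun z => frameMap κ r (g z)) z₀ hinv hM
  have hcomp : ContDiff ℝ n
      (fun z : (((Fin r → ℂ) × (Fin r → ℂ)) →L[ℂ] F) × (F →L[ℂ] ((Fin r → ℂ) × (Fin r → ℂ))) =>
        (z.1.comp J).comp z.2) := by
    have h : ContDiff ℂ n
      (fun z : (((Fin r → ℂ) × (Fin r → ℂ)) →L[ℂ] F) × (F →L[ℂ] ((Fin r → ℂ) × (Fin r → ℂ))) =>
        (z.1.comp J).comp z.2) :=
      (contDiff_fst.clm_comp contDiff_const).clm_comp contDiff_snd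
    exact h.restrict_scalars ℝ
  have hfinal : ContDiffAt ℝ n (fun z => ((frameMap κ r (g z)).comp J).comp
      (ContinuousLinearMap.inverse (frameMap κ r (g z)))) z₀ :=
    hcomp.contDiffAt.comp z₀ (hM.prodMk hN)
  refine hfinal.congr_of_eventuallyEq ?_
  -- Invertibility is an open condition, so near `z₀` the totalized inverse is a genuine one.
  have hnear : ∀ᶠ z in 𝓝 z₀, frameMap κ r (g z) ∈
      Set.range ((↑) : (((Fin r → ℂ) × (Fin r → ℂ)) ≃L[ℂ] F) → _) := by
    have h := ContinuousLinearEquiv.nhds ε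
    rw [hε] at h
    exact hM.continuousAt.eventually_mem h
  filter_upwards [hnear, hp] with z ⟨η, hη⟩ hz
  have hcomm : (p z).comp (frameMap κ r (g z)) = (frameMap κ r (g z)).comp J := by
    refine ContinuousLinearMap.ext fun ⟨a, b⟩ => ?_
    change p z (frameMap κ r (g z) (a, b)) = frameMap κ r (g z) (a, 0)
    simp only [frameMap_apply, map_add, map_sum, map_smul, (hz _).1, (hz _).2]
    simp
  rw [← hcomm, ← hη, ContinuousLinearMap.inverse_equiv]
  ext w
  simp

end Frames

/-! ### The variation as a Hodge family in a flat trivialization -/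

namespace PolarizedVHS

variable {B : Type*} [TopologicalSpace B]
  {E : Type*} [NormedAddCommGroup E] [NormedSpace ℂ E] [ChartedSpace E B]
  {F : Type*} [NormedAddCommGroup F] [NormedSpace ℂ F]
  {V : B → Type*} [∀ x, AddCommGroup (V x)] [∀ x, Module ℂ (V x)] [∀ x, TopologicalSpace (V x)]
  [TopologicalSpace (TotalSpace F V)] [FiberBundle F V] [VectorBundle ℂ F V]
  (D : PolarizedVHS E F V)

theorem isFlatAt_symmₗ [IsFlatBundle F V]
    (e : Trivialization F (TotalSpace.proj : TotalSpace F V → B)) [MemTrivializationAtlas e]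
    {x : B} (hx : x ∈ e.baseSet) (v : F) : IsFlatAt F (fun y => e.symmₗ ℂ y v) x := by
  intro e' _ hx'
  filter_upwards [IsFlatBundle.eventually_coordChange_eq e e' x ⟨hx, hx'⟩,
    e.open_baseSet.mem_nhds hx, e'.open_baseSet.mem_nhds hx'] with y hy h1 h2
  have h := congrArg (fun L : F ≃L[ℂ] F => L v) hy
  simp only [Trivialization.coordChangeL_apply e e' ⟨h1, h2⟩,
    Trivialization.coordChangeL_apply e e' ⟨hx, hx'⟩] at h
  rw [e.symmₗ_apply h1, e.symmₗ_apply hx]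
  exact h

/-- Flatness of `Q` is applied to the flat sections through a finite basis, so one neighbourhood
serves all `v` and `w`. -/
theorem eventually_Q_eq [FiniteDimensional ℂ F] [IsFlatBundle F V]
    (e : Trivialization F (TotalSpace.proj : TotalSpace F V → B)) [MemTrivializationAtlas e]
    {x : B} (hx : x ∈ e.baseSet) :
    ∀ᶠ y in 𝓝 x, ∀ v w : F, D.Q y (e.symmₗ ℂ y v) (e.symmₗ ℂ y w) =
      D.Q x (e.symmₗ ℂ x v) (e.symmₗ ℂ x w) := by
  let β := Module.finBasis ℂ F
  have hall : ∀ᶠ y in 𝓝 x, ∀ i j, D.Q y (e.symmₗ ℂ y (β i)) (e.symmₗ ℂ y (β j)) =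
      D.Q x (e.symmₗ ℂ x (β i)) (e.symmₗ ℂ x (β j)) :=
    Filter.eventually_all.2 fun i => Filter.eventually_all.2 fun j =>
      D.Q_flat _ _ x (isFlatAt_symmₗ e hx (β i)) (isFlatAt_symmₗ e hx (β j))
  filter_upwards [hall] with y hy v w
  rw [← β.sum_repr v, ← β.sum_repr w]
  simp only [map_sum, map_smul, LinearMap.sum_apply, LinearMap.smul_apply, hy]

theorem proj10_of_mem (x : B) {a : V x} (ha : a ∈ D.H10 x) : D.proj10 x a = a :=
  Submodule.projection_apply_of_mem_left _ ha

theorem proj10_mem (x : B) (v : V x) : D.proj10 x v ∈ D.H10 x := by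
  obtain ⟨a, ha, b, hb, rfl⟩ := D.exists_decomp x v
  rwa [D.proj10_apply x ha hb]

theorem proj01_eq (x : B) (v : V x) : D.proj01 x v = v - D.proj10 x v := by
  obtain ⟨a, ha, b, hb, rfl⟩ := D.exists_decomp x v
  rw [D.proj10_apply x ha hb, D.proj01_apply x ha hb, add_sub_cancel_left]

theorem conj_mem_H01 (x : B) {a : V x} (ha : a ∈ D.H10 x) : D.conj x a ∈ D.H01 x := ⟨a, ha, rfl⟩

theorem conj_mem_H10 (x : B) {a : V x} (ha : a ∈ D.H01 x) : D.conj x a ∈ D.H10 x := by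
  obtain ⟨b, hb, rfl⟩ := ha
  rwa [D.conj_conj]

theorem proj10_of_mem_H01 (x : B) {a : V x} (ha : a ∈ D.H01 x) : D.proj10 x a = 0 :=
  Submodule.projection_apply_of_mem_right _ ha

theorem conj_proj10_conj (x : B) (v : V x) :
    D.conj x (D.proj10 x (D.conj x v)) = v - D.proj10 x v := by
  obtain ⟨a, ha, b, hb, rfl⟩ := D.exists_decomp x v
  rw [map_add, D.conj_conj, add_comm (D.conj x a), D.proj10_apply x hb ha, D.proj10_apply x ha hb,
    add_sub_cancel_left]

/-- `H^{1,0}` and `H^{0,1}` are both isotropic, so each side pairs the `(1,0)`-part of `v` with the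
`(0,1)`-part of `w`. -/
theorem Q_proj10 (x : B) (v w : V x) :
    D.Q x (D.proj10 x v) w = D.Q x v (w - D.proj10 x w) := by
  obtain ⟨a, ha, b, hb, rfl⟩ := D.exists_decomp x v
  obtain ⟨c, hc, d, hd, rfl⟩ := D.exists_decomp x w
  rw [D.proj10_apply x ha hb, D.proj10_apply x hc hd, add_sub_cancel_left]
  simp only [map_add, LinearMap.add_apply, D.Q_H10 x a ha c hc, D.Q_conj, D.Q_H10 x b hb d hd,
    map_zero, zero_add, add_zero]

/-- Complex conjugation, read in a flat trivialization. -/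
def conjIn (e : Trivialization F (TotalSpace.proj : TotalSpace F V → B))
    [MemTrivializationAtlas e] (x : B) : F →ₛₗ[starRingEnd ℂ] F :=
  (e.linearMapAt ℂ x).comp ((D.conj x).comp (e.symmₗ ℂ x))

/-- The polarization, read in a flat trivialization. -/
def QIn (e : Trivialization F (TotalSpace.proj : TotalSpace F V → B))
    [MemTrivializationAtlas e] (x : B) : F →ₗ[ℂ] F →ₗ[ℂ] ℂ :=
  (D.Q x).compl₁₂ (e.symmₗ ℂ x) (e.symmₗ ℂ x)

/-- The projection to `H^{1,0}`, read in a trivialization and in the holomorphic chart at `x`. -/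
def proj10Chart [FiniteDimensional ℂ F]
    (e : Trivialization F (TotalSpace.proj : TotalSpace F V → B))
    [MemTrivializationAtlas e] (x : B) (z : E) : F →L[ℂ] F :=
  D.proj10In e ((extChartAt 𝓘(ℂ, E) x).symm z)

theorem proj10In_linearMapAt [FiniteDimensional ℂ F]
    (e : Trivialization F (TotalSpace.proj : TotalSpace F V → B))
    [MemTrivializationAtlas e] {x : B} (hx : x ∈ e.baseSet) (v : V x) :
    D.proj10In e x (e.linearMapAt ℂ x v) = e.linearMapAt ℂ x (D.proj10 x v) := by
  change e.linearMapAt ℂ x (D.proj10 x (e.symmₗ ℂ x (e.linearMapAt ℂ x v))) = _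
  rw [e.symmₗ_linearMapAt hx]

/-- A frame of `H^{1,0}` together with its conjugate is a basis of the fiber, by the Hodge
decomposition. -/
theorem bijective_frameMap [FiniteDimensional ℂ F]
    (e : Trivialization F (TotalSpace.proj : TotalSpace F V → B)) [MemTrivializationAtlas e]
    {x : B} (hx : x ∈ e.baseSet) {r : ℕ} {f : Fin r → V x} (hli : LinearIndependent ℂ f)
    (hspan : Submodule.span ℂ (Set.range f) = D.H10 x) :
    Function.Bijective (frameMap (D.conjIn e x) r fun j => e.linearMapAt ℂ x (f j)) := by
  have happ : ∀ a b, frameMap (D.conjIn e x) r (fun j => e.linearMapAt ℂ x (f j)) (a, b) =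
      e.linearMapAt ℂ x (∑ j, a j • f j + D.conj x (∑ j, starRingEnd ℂ (b j) • f j)) := by
    intro a b
    simp only [frameMap_apply, conjIn, LinearMap.comp_apply, e.symmₗ_linearMapAt hx, map_add,
      map_sum, map_smul, LinearMap.map_smulₛₗ, Complex.conj_conj]
  have hmem : ∀ p : Fin r → ℂ, ∑ j, p j • f j ∈ D.H10 x := fun p => by
    rw [← hspan]
    exact Submodule.sum_mem _ fun j _ => Submodule.smul_mem _ _ (Submodule.subset_span ⟨j, rfl⟩)
  have hcoef : ∀ p : Fin r → ℂ, ∑ j, p j • f j = 0 → p = 0 := fun p hp =>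
    funext fun j => Fintype.linearIndependent_iff.1 hli p hp j
  constructor
  · rw [injective_iff_map_eq_zero]
    rintro ⟨a, b⟩ hab
    rw [happ] at hab
    have h0 := congrArg (e.symmₗ ℂ x) hab
    rw [e.symmₗ_linearMapAt hx, map_zero] at h0
    have h1 := congrArg (D.proj10 x) h0
    have h2 := congrArg (D.proj01 x) h0
    rw [D.proj10_apply x (hmem _) (hmem _), map_zero] at h1
    rw [D.proj01_apply x (hmem _) (hmem _), map_zero] at h2
    have h3 := congrArg (D.conj x) h2
    rw [D.conj_conj, map_zero] at h3
    have h5 := hcoef _ h3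
    have h6 : b = 0 := funext fun j => by simpa using congrFun h5 j
    rw [hcoef a h1, h6]; rfl
  · intro w
    obtain ⟨a, ha, b, hb, hab⟩ := D.exists_decomp x (e.symmₗ ℂ x w)
    rw [← hspan, Submodule.mem_span_range_iff_exists_fun] at ha hb
    obtain ⟨p, rfl⟩ := ha
    obtain ⟨q, rfl⟩ := hb
    refine ⟨(p, fun j => starRingEnd ℂ (q j)), ?_⟩
    rw [happ]
    simp only [Complex.conj_conj]
    rw [← hab, e.linearMapAt_symmₗ hx]

/-- Flatness lets the conjugation and polarization read at `x` serve at all nearby points. The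
holomorphic frame of `H^{1,0}` provides both the analyticity of the projection and the condition
`holo`. -/
theorem isHodgeFamily [FiniteDimensional ℂ F] [IsFlatBundle F V]
    (e : Trivialization F (TotalSpace.proj : TotalSpace F V → B)) [MemTrivializationAtlas e]
    {x : B} (hx : x ∈ e.baseSet) :
    IsHodgeFamily (D.conjIn e x) (D.QIn e x) (D.proj10Chart e x : E → F →L[ℂ] F)
      (extChartAt 𝓘(ℂ, E) x x) := by
  have hψ := tendsto_extChartAt_symm (E := E) x
  have hψx : (extChartAt 𝓘(ℂ, E) x).symm (extChartAt 𝓘(ℂ, E) x x) = x := extChartAt_to_inv x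
  have hbase := e.open_baseSet.mem_nhds hx
  have hconj := D.eventually_conj_eq e x hx
  have hidem : ∀ y, y ∈ e.baseSet → D.proj10In e y * D.proj10In e y = D.proj10In e y := by
    intro y hy
    ext w
    change e.linearMapAt ℂ y (D.proj10 y (e.symmₗ ℂ y (e.linearMapAt ℂ y
      (D.proj10 y (e.symmₗ ℂ y w))))) = e.linearMapAt ℂ y (D.proj10 y (e.symmₗ ℂ y w))
    rw [e.symmₗ_linearMapAt hy, D.proj10_of_mem y (D.proj10_mem y _)]
  obtain ⟨r, f, hol, hframe⟩ := D.H10_holomorphic x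
  let g : E → Fin r → F := fun z j =>
    (e ⟨(extChartAt 𝓘(ℂ, E) x).symm z, f j ((extChartAt 𝓘(ℂ, E) x).symm z)⟩).2
  have hgC : ∀ j, ContDiffAt ℂ ω (fun z => g z j) (extChartAt 𝓘(ℂ, E) x x) := fun j =>
    (hol j e hx).contDiffAt_chart
  have hg_eq : ∀ᶠ z in 𝓝 (extChartAt 𝓘(ℂ, E) x x), ∀ j, g z j = e.linearMapAt ℂ _
      (f j ((extChartAt 𝓘(ℂ, E) x).symm z)) := by
    filter_upwards [hψ.eventually hbase] with z hz j
    rw [e.coe_linearMapAt_of_mem hz]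
  have hpg : ∀ᶠ z in 𝓝 (extChartAt 𝓘(ℂ, E) x x), ∀ j, D.proj10Chart e x z (g z j) = g z j := by
    filter_upwards [hψ.eventually hbase, hψ.eventually hframe, hg_eq] with z h1 h2 h3 j
    rw [h3, proj10Chart, D.proj10In_linearMapAt e h1, D.proj10_of_mem]
    rw [← h2.2]
    exact Submodule.subset_span ⟨j, rfl⟩
  have hpκg : ∀ᶠ z in 𝓝 (extChartAt 𝓘(ℂ, E) x x), ∀ j,
      D.proj10Chart e x z (D.conjIn e x (g z j)) = 0 := by
    filter_upwards [hψ.eventually hbase, hψ.eventually hframe, hg_eq, hψ.eventually hconj]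
      with z h1 h2 h3 h4 j
    change D.proj10Chart e x z (e.linearMapAt ℂ x (D.conj x (e.symmₗ ℂ x (g z j)))) = 0
    rw [← h4, h3, e.symmₗ_linearMapAt h1, proj10Chart, D.proj10In_linearMapAt e h1,
      D.proj10_of_mem_H01, map_zero]
    refine D.conj_mem_H01 _ ?_
    rw [← h2.2]
    exact Submodule.subset_span ⟨j, rfl⟩
  refine ⟨?_, ?_, ?_, ?_, ?_, ?_⟩
  · refine contDiffAt_of_frame (D.conjIn e x) (g := g)
      (contDiffAt_pi.2 fun j => (hgC j).restrict_scalars ℝ) ?_ ?_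
    · filter_upwards [hpg, hpκg] with z h1 h2 j using ⟨h1 j, h2 j⟩
    · have h1 := hg_eq.self_of_nhds
      have h2 := hframe.self_of_nhds
      have h3 : g (extChartAt 𝓘(ℂ, E) x x) = fun j => e.linearMapAt ℂ x (f j x) := by
        funext j
        rw [h1 j, hψx]
      rw [h3]
      exact D.bijective_frameMap e hx h2.1 h2.2
  · intro w
    simp only [conjIn, LinearMap.comp_apply, e.symmₗ_linearMapAt hx, D.conj_conj,
      e.linearMapAt_symmₗ hx]
  · exact hψ.eventually (Filter.mem_of_superset hbase hidem)
  · filter_upwards [hψ.eventually hbase, hψ.eventually hconj] with z h1 h2 w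
    have h3 : ∀ w, D.conjIn e x w = e.linearMapAt ℂ _ (D.conj ((extChartAt 𝓘(ℂ, E) x).symm z)
      (e.symmₗ ℂ _ w)) := fun w => (h2 w).symm
    rw [h3, h3, proj10Chart, D.proj10In_linearMapAt e h1, e.symmₗ_linearMapAt h1,
      D.conj_proj10_conj, map_sub, e.linearMapAt_symmₗ h1]
    rfl
  · filter_upwards [hψ.eventually hbase, hψ.eventually (D.eventually_Q_eq e hx)] with z h1 h2 v w
    change D.Q x (e.symmₗ ℂ x _) (e.symmₗ ℂ x w) = D.Q x (e.symmₗ ℂ x v) (e.symmₗ ℂ x (w - _))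
    rw [← h2, ← h2, map_sub]
    change D.Q _ (e.symmₗ ℂ _ (e.linearMapAt ℂ _ (D.proj10 _ (e.symmₗ ℂ _ v)))) _ =
      D.Q _ _ (_ - e.symmₗ ℂ _ (e.linearMapAt ℂ _ (D.proj10 _ (e.symmₗ ℂ _ w))))
    rw [e.symmₗ_linearMapAt h1, e.symmₗ_linearMapAt h1, D.Q_proj10]
  · have hgd : ∀ᶠ z in 𝓝 (extChartAt 𝓘(ℂ, E) x x), ∀ j, ContDiffAt ℂ ω (fun z => g z j) z :=
      Filter.eventually_all.2 fun j => (hgC j).eventually (by simp)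
    filter_upwards [hψ.eventually hbase, hψ.eventually hframe, hg_eq, hgd, hpg.eventually_nhds]
      with z h1 h2 h3 h4 h5
    refine ⟨r, fun j y => g y j, fun j => (h4 j).differentiableAt (by simp), h5, fun w => ?_⟩
    have h6 : D.proj10 _ (e.symmₗ ℂ _ w) ∈
      Submodule.span ℂ (Set.range fun j => f j ((extChartAt 𝓘(ℂ, E) x).symm z)) := by
      rw [h2.2]; exact D.proj10_mem _ _
    have h7 := Submodule.mem_map_of_mem (f := e.linearMapAt ℂ _) h6
    rw [Submodule.map_span, ← Set.range_comp] at h7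
    have h8 : (fun j => g z j) = e.linearMapAt ℂ ((extChartAt 𝓘(ℂ, E) x).symm z) ∘
      fun j => f j ((extChartAt 𝓘(ℂ, E) x).symm z) := funext h3
    rw [h8]
    exact h7

end PolarizedVHS

end

noncomputable section

/-! ### The linear algebra of the trace identity -/

section TraceIdentity

variable {W K : Type*} [AddCommGroup W] [Module ℂ W] [FiniteDimensional ℂ W] [AddCommGroup K]
  [Module ℂ K] [FiniteDimensional ℂ K]

/-- Here `S`, `T`, `Gi` stand for `∂p`, `∂̄p`, `G⁻¹`. By the block relations the product on the
right expands into four terms; cyclicity moves the traces of those containing `Gi` from `W` to `K`.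
The identity holds for any endomorphism `Gi`. -/
theorem trace_projection_identity (P S T : W →ₗ[ℂ] W) (J : K →ₗ[ℂ] W) (Λ : W →ₗ[ℂ] K)
    (Gi : K →ₗ[ℂ] K) (hTP : ∀ w, T (P w) = 0) (hPT : ∀ w, P (T w) = T w)
    (hSP : ∀ w, S (P w) = S w) (hPS : ∀ w, P (S w) = 0) :
    LinearMap.trace ℂ K (Gi ∘ₗ Λ ∘ₗ (S ∘ₗ T - T ∘ₗ S) ∘ₗ J) -
      LinearMap.trace ℂ K (Gi ∘ₗ Λ ∘ₗ S ∘ₗ J ∘ₗ Gi ∘ₗ Λ ∘ₗ T ∘ₗ J) =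
    LinearMap.trace ℂ W (S ∘ₗ (-T)) -
      LinearMap.trace ℂ W (S ∘ₗ (P - P ∘ₗ J ∘ₗ Gi ∘ₗ Λ ∘ₗ P) ∘ₗ (-T) ∘ₗ
        ((LinearMap.id - P) + (LinearMap.id - P) ∘ₗ J ∘ₗ Gi ∘ₗ Λ ∘ₗ (LinearMap.id - P))) := by
  have e : S ∘ₗ (P - P ∘ₗ J ∘ₗ Gi ∘ₗ Λ ∘ₗ P) ∘ₗ (-T) ∘ₗ
        ((LinearMap.id - P) + (LinearMap.id - P) ∘ₗ J ∘ₗ Gi ∘ₗ Λ ∘ₗ (LinearMap.id - P)) =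
      S ∘ₗ (-T) - (S ∘ₗ T ∘ₗ J) ∘ₗ (Gi ∘ₗ Λ ∘ₗ (LinearMap.id - P)) +
        (S ∘ₗ J) ∘ₗ (Gi ∘ₗ Λ ∘ₗ T) +
        (S ∘ₗ J ∘ₗ Gi ∘ₗ Λ ∘ₗ T ∘ₗ J) ∘ₗ (Gi ∘ₗ Λ ∘ₗ (LinearMap.id - P)) := by
    ext w
    simp only [LinearMap.comp_apply, LinearMap.sub_apply, LinearMap.add_apply, LinearMap.neg_apply,
      LinearMap.id_apply, map_sub, map_add, map_neg, hTP, hPT, hSP, map_zero]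
    abel
  have f : ∀ X : W →ₗ[ℂ] W, (LinearMap.id - P) ∘ₗ S ∘ₗ X = S ∘ₗ X := fun X => by
    ext w
    simp [hPS]
  -- The image of `S` lies in the kernel of `P`, so a factor `1 - P` may be inserted before `S` to
  -- match the expansion.
  have e1 : Gi ∘ₗ Λ ∘ₗ (S ∘ₗ T - T ∘ₗ S) ∘ₗ J =
      (Gi ∘ₗ Λ ∘ₗ (LinearMap.id - P)) ∘ₗ (S ∘ₗ T ∘ₗ J) - (Gi ∘ₗ Λ ∘ₗ T) ∘ₗ (S ∘ₗ J) := by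
    ext w
    simp [hPS]
  have e2 : Gi ∘ₗ Λ ∘ₗ S ∘ₗ J ∘ₗ Gi ∘ₗ Λ ∘ₗ T ∘ₗ J =
      (Gi ∘ₗ Λ ∘ₗ (LinearMap.id - P)) ∘ₗ (S ∘ₗ J ∘ₗ Gi ∘ₗ Λ ∘ₗ T ∘ₗ J) := by
    ext w
    simp [hPS]
  rw [e, e1, e2, map_add, map_add, map_sub, map_sub,
    LinearMap.trace_comp_comm' (S ∘ₗ T ∘ₗ J), LinearMap.trace_comp_comm' (S ∘ₗ J),
    LinearMap.trace_comp_comm' (S ∘ₗ J ∘ₗ Gi ∘ₗ Λ ∘ₗ T ∘ₗ J)]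
  ring

end TraceIdentity

theorem linearCombination_map_mem {W : Type*} [AddCommGroup W] [Module ℂ W] {k : ℕ}
    (c : Fin k → W) (f : W →ₗ[ℂ] W) (a : Fin k → ℂ) :
    f (Fintype.linearCombination ℂ c a) ∈ Submodule.span ℂ (Set.range fun i => f (c i)) := by
  rw [Fintype.linearCombination_apply, map_sum]
  refine Submodule.sum_mem _ fun i _ => ?_
  rw [map_smul]
  exact Submodule.smul_mem _ _ (Submodule.subset_span ⟨i, rfl⟩)

/-! ### The Hodge metric and the Gram endomorphism -/

namespace PolarizedVHS

variable {B : Type*} [TopologicalSpace B]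
  {E : Type*} [NormedAddCommGroup E] [NormedSpace ℂ E] [ChartedSpace E B]
  {F : Type*} [NormedAddCommGroup F] [NormedSpace ℂ F]
  {V : B → Type*} [∀ x, AddCommGroup (V x)] [∀ x, Module ℂ (V x)] [∀ x, TopologicalSpace (V x)]
  [TopologicalSpace (TotalSpace F V)] [FiberBundle F V] [VectorBundle ℂ F V]
  (D : PolarizedVHS E F V)

theorem hodge_conj_symm (x : B) (u v : V x) :
    starRingEnd ℂ (D.hodge x u v) = D.hodge x v u :=
  (D.hodgeCore x).conj_inner_symm u v

theorem hodge_add_left (x : B) (u v w : V x) :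
    D.hodge x (u + v) w = D.hodge x u w + D.hodge x v w := by simp [hodge]

theorem hodge_sub_left (x : B) (u v w : V x) :
    D.hodge x (u - v) w = D.hodge x u w - D.hodge x v w := by simp [hodge]

theorem eq_zero_of_hodge_self (x : B) {u : V x} (h : D.hodge x u u = 0) : u = 0 :=
  (D.hodgeCore x).definite u h

theorem hodge_conj_conj (x : B) (u v : V x) :
    D.hodge x (D.conj x u) (D.conj x v) = starRingEnd ℂ (D.hodge x u v) := by
  obtain ⟨a, ha, b, hb, rfl⟩ := D.exists_decomp x u
  obtain ⟨c, hc, d, hd, rfl⟩ := D.exists_decomp x v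
  rw [D.hodge_conj_symm, map_add, map_add, D.conj_conj, D.conj_conj, add_comm (D.conj x a),
    add_comm (D.conj x c), D.hodge_apply x hb ha hd hc, D.hodge_apply x hc hd ha hb,
    D.Q_swap x b, D.Q_swap x c]
  ring

theorem hodge_H10_H01 (x : B) {u v : V x} (hu : u ∈ D.H10 x) (hv : v ∈ D.H01 x) :
    D.hodge x u v = 0 := by
  obtain ⟨b, hb, rfl⟩ := hv
  have h := D.hodge_apply x hu (D.H10 x).zero_mem (D.H10 x).zero_mem hb
  simpa using h

theorem hodge_H01_H10 (x : B) {u v : V x} (hu : u ∈ D.H01 x) (hv : v ∈ D.H10 x) :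
    D.hodge x u v = 0 := by
  rw [← D.hodge_conj_symm, D.hodge_H10_H01 x hv hu, map_zero]

theorem weil_of_mem (x : B) {w : V x} (hw : w ∈ D.H10 x) : D.weil x w = I • w := by
  simp [weil, D.proj01_eq, D.proj10_of_mem x hw]

theorem weil_of_mem_H01 (x : B) {w : V x} (hw : w ∈ D.H01 x) : D.weil x w = -(I • w) := by
  simp [weil, D.proj01_eq, D.proj10_of_mem_H01 x hw]

theorem proj01_mem (x : B) (v : V x) : D.proj01 x v ∈ D.H01 x := by
  obtain ⟨a, ha, b, hb, rfl⟩ := D.exists_decomp x v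
  rw [D.proj01_apply x ha hb]
  exact D.conj_mem_H01 x hb

theorem Q_H01 (x : B) {u v : V x} (hu : u ∈ D.H01 x) (hv : v ∈ D.H01 x) : D.Q x u v = 0 := by
  obtain ⟨a, ha, rfl⟩ := hu
  obtain ⟨b, hb, rfl⟩ := hv
  rw [D.Q_conj, D.Q_H10 x a ha b hb, map_zero]

theorem conj_proj01 (x : B) {c : V x} (hc : D.conj x c = c) :
    D.conj x (D.proj01 x c) = D.proj10 x c := by
  rw [D.proj01_eq, ← D.conj_proj10_conj, D.conj_conj, hc]

/-- Conjugation sends `π^{0,1}c` to `π^{1,0}c`, which may be replaced by `c` because `H^{0,1}` is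
isotropic. Orthogonality to the `φ_i` thus becomes the linear condition `Q(w, c_i) = 0`. -/
theorem hodge_proj01 (x : B) {w c : V x} (hw : w ∈ D.H01 x) (hc : D.conj x c = c) :
    D.hodge x w (D.proj01 x c) = -(I * D.Q x w c) := by
  have h : D.Q x w c = D.Q x w (D.proj10 x c) + D.Q x w (D.proj01 x c) := by
    rw [← map_add, D.proj01_eq, add_sub_cancel]
  rw [hodge, D.weil_of_mem_H01 x hw, D.conj_proj01 x hc, h, D.Q_H01 x hw (D.proj01_mem x c)]
  simp

theorem hodge_proj10 (x : B) {w c : V x} (hw : w ∈ D.H10 x) (hc : D.conj x c = c) :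
    D.hodge x w (D.proj10 x c) = I * D.Q x w c := by
  have h : D.Q x w c = D.Q x w (D.proj10 x c) + D.Q x w (D.proj01 x c) := by
    rw [← map_add, D.proj01_eq, add_sub_cancel]
  rw [hodge, D.weil_of_mem x hw, ← D.conj_proj01 x hc, D.conj_conj, h,
    D.Q_H10 x w hw _ (D.proj10_mem x c)]
  simp

/-- Isotropy gives `Q(π^{0,1}u, v) = -Q(π^{1,0}u, v)`, and the opposite signs in the Weil operator
make the two contributions equal. The Gram matrix is thereby linear in the projection `π^{1,0}`. -/
theorem hodge_of_Q_eq_zero (x : B) {u v : V x} (hv : D.conj x v = v) (h : D.Q x u v = 0) :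
    D.hodge x u v = 2 * I * D.Q x (D.proj10 x u) v := by
  have h1 : D.proj10 x u = u - D.proj01 x u := by rw [D.proj01_eq, sub_sub_cancel]
  have h2 : D.Q x (D.proj01 x u) v = - D.Q x (D.proj10 x u) v := by
    rw [D.proj01_eq, map_sub, LinearMap.sub_apply, h, zero_sub]
  rw [hodge, weil, hv]
  simp only [LinearMap.sub_apply, LinearMap.smul_apply, map_sub, map_smul, smul_eq_mul, h2]
  ring

theorem adjoint_eq [FiniteDimensional ℂ F] (x : B) {S T : V x →ₗ[ℂ] V x}
    (h : ∀ u v, D.hodge x v (T u) = D.hodge x (S v) u) : D.adjoint x T = S := by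
  have := finiteDimensional_fiber F V x
  ext v
  have h1 : ∀ u, D.hodge x v (T u) = D.hodge x (D.adjoint x T v) u := fun u =>
    HermitianLinearAlgebra.adjoint_spec (D.hodgeCore x) T u v
  refine sub_eq_zero.1 (D.eq_zero_of_hodge_self x ?_)
  rw [hodge_sub_left, ← h1, h, sub_self]

theorem orthProj_eq [FiniteDimensional ℂ F] (x : B) {K : Submodule ℂ (V x)}
    {R : V x →ₗ[ℂ] V x} (hR : ∀ v, R v ∈ K) (h : ∀ v, ∀ u ∈ K, D.hodge x (v - R v) u = 0) :
    D.orthProj x K = R := by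
  have := finiteDimensional_fiber F V x
  ext v
  obtain ⟨h1, h2⟩ := HermitianLinearAlgebra.orthogonalProjection_spec (D.hodgeCore x) K v
  rw [HermitianLinearAlgebra.mem_orthogonal] at h2
  have h3 : ∀ u ∈ K, D.hodge x (v - D.orthProj x K v) u = 0 := h2
  have h4 : D.orthProj x K v - R v ∈ K := K.sub_mem h1 (hR v)
  refine sub_eq_zero.1 (D.eq_zero_of_hodge_self x ?_)
  have h5 : D.hodge x (D.orthProj x K v - R v) (D.orthProj x K v - R v) =
      D.hodge x (v - R v) (D.orthProj x K v - R v) -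
        D.hodge x (v - D.orthProj x K v) (D.orthProj x K v - R v) := by
    rw [← hodge_sub_left]
    congr 1
    abel
  rw [h5, h v _ h4, h3 _ h4, sub_zero]

/-- The functionals `2i Q(·, c_j)`. -/
def polar (x : B) {k : ℕ} (c : Fin k → V x) : V x →ₗ[ℂ] (Fin k → ℂ) :=
  LinearMap.pi fun j => (2 * I) • (D.Q x).flip (c j)

theorem polar_apply (x : B) {k : ℕ} (c : Fin k → V x) (w : V x) (j : Fin k) :
    D.polar x c w j = 2 * I * D.Q x w (c j) := rfl

/-- The endomorphism of `ℂᵏ` whose matrix is the Gram matrix of a real isotropic family. -/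
def gramEnd (x : B) {k : ℕ} (c : Fin k → V x) : (Fin k → ℂ) →ₗ[ℂ] (Fin k → ℂ) :=
  D.polar x c ∘ₗ D.proj10 x ∘ₗ Fintype.linearCombination ℂ c

/-- The Hodge metric takes real values on real vectors, so taking real parts in the Gram matrix
loses nothing. -/
theorem wedgeNormSq_eq_det (x : B) {k : ℕ} (c : Fin k → D.realFiber x)
    (hc : ∀ i j, D.Q x (c i) (c j) = 0) :
    (D.wedgeNormSq x (exteriorPower.ιMulti ℝ k c) : ℂ) =
      LinearMap.det (D.gramEnd x fun i => (c i : V x)) := by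
  have hreal : ∀ i, D.conj x (c i) = c i := fun i => (c i).2
  rw [D.wedgeNormSq_ιMulti, ← LinearMap.det_toMatrix']
  change Complex.ofRealHom _ = _
  rw [RingHom.map_det]
  congr 1
  ext i j
  have h1 : starRingEnd ℂ (D.hodge x (c j) (c i)) = D.hodge x (c j) (c i) := by
    rw [← D.hodge_conj_conj, hreal, hreal]
  have h2 := Complex.conj_eq_iff_re.1 h1
  have h3 : LinearMap.toMatrix' (D.gramEnd x fun i => (c i : V x)) i j =
      2 * I * D.Q x (D.proj10 x (c j)) (c i) := by
    rw [LinearMap.toMatrix'_apply]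
    simp only [gramEnd, LinearMap.comp_apply, polar_apply]
    simp [Fintype.linearCombination_apply, Pi.single_apply]
  rw [h3, ← D.hodge_of_Q_eq_zero x (hreal i) (hc j i)]
  exact h2

theorem wedgeNormSq_pos (x : B) {k : ℕ} (c : Fin k → D.realFiber x)
    (hc : LinearIndependent ℝ c) : 0 < D.wedgeNormSq x (exteriorPower.ιMulti ℝ k c) := by
  rw [D.wedgeNormSq_ιMulti]
  refine Matrix.PosDef.det_pos (Matrix.PosDef.of_dotProduct_mulVec_pos ?_ ?_)
  · ext i j
    simp only [Matrix.conjTranspose_apply, Matrix.of_apply, star_trivial]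
    rw [← D.hodge_conj_symm, Complex.conj_re]
  · intro a ha
    have h0 : ∑ i, a i • c i ≠ 0 := fun h =>
      ha (funext fun i => Fintype.linearIndependent_iff.1 hc a h i)
    set s := ∑ i, a i • c i with hs
    have h1 : star a ⬝ᵥ (Matrix.of fun i j => (D.hodge x (c j) (c i)).re).mulVec a =
        D.hodgeReal x s s := by
      simp only [hs, map_sum, map_smul, LinearMap.sum_apply, LinearMap.smul_apply, dotProduct,
        Matrix.mulVec, Matrix.of_apply, star_trivial, smul_eq_mul]
      simp only [Finset.mul_sum]
      refine Finset.sum_congr rfl fun i _ => Finset.sum_congr rfl fun j _ => ?_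
      change _ = a i * (a j * (D.hodge x (c j) (c i)).re)
      ring
    rw [h1]
    have h2 : 0 ≤ (D.hodge x s s).re := (D.hodgeCore x).re_inner_nonneg (s : V x)
    refine lt_of_le_of_ne h2 fun h3 => h0 (Subtype.ext (D.eq_zero_of_hodge_self x ?_))
    have h4 : (D.hodge x s s).im = 0 := Complex.conj_eq_iff_im.1 (D.hodge_conj_symm x _ _)
    exact Complex.ext h3.symm h4

/-! ### Isotropic families: independence and orthogonal projections -/

section Isotropic

variable (x : B) {k : ℕ} (c : Fin k → V x)
  (hiso : ∀ i j, D.Q x (c i) (c j) = 0)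
include hiso

theorem polar_linearCombination (a : Fin k → ℂ) :
    D.polar x c (Fintype.linearCombination ℂ c a) = 0 := by
  ext j
  simp [polar_apply, Fintype.linearCombination_apply, hiso]

theorem polar_proj01_linearCombination (a : Fin k → ℂ) :
    D.polar x c (D.proj01 x (Fintype.linearCombination ℂ c a)) = -D.gramEnd x c a := by
  rw [D.proj01_eq, map_sub, D.polar_linearCombination x c hiso, zero_sub]
  rfl

/-- Applying `Λ` to a relation `π^{0,1} J a = 0` gives `G a = 0`, because `Λ J = 0`. -/
theorem linearIndependent_proj01 (hdet : LinearMap.det (D.gramEnd x c) ≠ 0) :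
    LinearIndependent ℂ fun i => D.proj01 x (c i) := by
  rw [Fintype.linearIndependent_iff]
  intro a ha
  have h1 : D.proj01 x (Fintype.linearCombination ℂ c a) = 0 := by
    simpa [Fintype.linearCombination_apply] using ha
  have h2 := D.polar_proj01_linearCombination x c hiso a
  rw [h1, map_zero, eq_comm, neg_eq_zero] at h2
  have h3 : a = 0 := by
    by_contra hne
    have h4 : LinearMap.ker (D.gramEnd x c) ≠ ⊥ := fun h =>
      hne ((LinearMap.ker_eq_bot'.1 h) a h2)
    exact hdet (LinearMap.det_eq_zero_iff_ker_ne_bot.2 h4)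
  exact fun i => congrFun h3 i

omit hiso in
theorem mem_perp01_span (hreal : ∀ i, D.conj x (c i) = c i) (w : V x) :
    w ∈ D.perp01 x (Submodule.span ℂ (Set.range fun i => D.proj01 x (c i))) ↔
      w ∈ D.H01 x ∧ D.polar x c w = 0 := by
  rw [perp01, Submodule.mem_inf, HermitianLinearAlgebra.mem_orthogonal, and_comm]
  refine and_congr_right fun hw => ?_
  have h1 : ∀ i, D.hodge x w (D.proj01 x (c i)) = 0 ↔ D.polar x c w i = 0 := fun i => by
    rw [D.hodge_proj01 x hw (hreal i), polar_apply]
    simp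
  constructor
  · intro h
    ext i
    exact (h1 i).1 (h _ (Submodule.subset_span ⟨i, rfl⟩))
  · intro h u hu
    change D.hodge x w u = 0
    induction hu using Submodule.span_induction with
    | mem u hu =>
      obtain ⟨i, rfl⟩ := hu
      exact (h1 i).2 (congrFun h i)
    | zero => simp [hodge]
    | add u v _ _ hu hv =>
      have : D.hodge x w (u + v) = D.hodge x w u + D.hodge x w v := by simp [hodge]
      rw [this, hu, hv, add_zero]
    | smul a u _ hu =>
      have : D.hodge x w (a • u) = starRingEnd ℂ a * D.hodge x w u := by simp [hodge]
      rw [this, hu, mul_zero]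

omit hiso in
theorem polar_conj (hreal : ∀ i, D.conj x (c i) = c i) (w : V x) (i : Fin k) :
    D.polar x c (D.conj x w) i = - starRingEnd ℂ (D.polar x c w i) := by
  have h : D.Q x (D.conj x w) (c i) = starRingEnd ℂ (D.Q x w (c i)) := by
    rw [← D.Q_conj, hreal]
  rw [polar_apply, polar_apply, h]
  simp [map_ofNat]

omit hiso in
-- Since the `c_i` are real, the kernel of `Λ` is stable under conjugation, which only replaces
-- `H^{0,1}` by `H^{1,0}`.
theorem mem_map_conj_perp01_span (hreal : ∀ i, D.conj x (c i) = c i) (w : V x) :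
    w ∈ (D.perp01 x (Submodule.span ℂ (Set.range fun i => D.proj01 x (c i)))).map (D.conj x) ↔
      w ∈ D.H10 x ∧ D.polar x c w = 0 := by
  have hp : ∀ v, D.polar x c v = 0 → D.polar x c (D.conj x v) = 0 := fun v hv => by
    ext i
    rw [D.polar_conj x c hreal, hv]
    simp
  constructor
  · rintro ⟨v, hv, rfl⟩
    have hv' := (D.mem_perp01_span x c hreal v).1 hv
    exact ⟨D.conj_mem_H10 x hv'.1, hp v hv'.2⟩
  · rintro ⟨h1, h2⟩
    exact ⟨D.conj x w, (D.mem_perp01_span x c hreal _).2 ⟨D.conj_mem_H01 x h1, hp w h2⟩,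
      D.conj_conj x w⟩

/-- The correction term lies in the span of the `φ_i`. Its plus sign is dictated by `Λ π^{0,1} J =
-G`, which makes `Λ` vanish on the result. -/
theorem orthProj_perp01 [FiniteDimensional ℂ F] (hreal : ∀ i, D.conj x (c i) = c i)
    (Gi : (Fin k → ℂ) →ₗ[ℂ] (Fin k → ℂ)) (hGi : ∀ a, D.gramEnd x c (Gi a) = a) :
    D.orthProj x (D.perp01 x (Submodule.span ℂ (Set.range fun i => D.proj01 x (c i)))) =
      D.proj01 x + D.proj01 x ∘ₗ Fintype.linearCombination ℂ c ∘ₗ Gi ∘ₗ D.polar x c ∘ₗ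
        D.proj01 x := by
  refine D.orthProj_eq x (fun v => ?_) fun v u hu => ?_
  · rw [D.mem_perp01_span x c hreal]
    simp only [LinearMap.add_apply, LinearMap.comp_apply]
    refine ⟨Submodule.add_mem _ (D.proj01_mem x _) (D.proj01_mem x _), ?_⟩
    rw [map_add, D.polar_proj01_linearCombination x c hiso, hGi, add_neg_cancel]
  · simp only [LinearMap.add_apply, LinearMap.comp_apply]
    have h1 : v - (D.proj01 x v + D.proj01 x (Fintype.linearCombination ℂ c
        (Gi (D.polar x c (D.proj01 x v))))) = D.proj10 x v - D.proj01 x (Fintype.linearCombination ℂ c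
        (Gi (D.polar x c (D.proj01 x v)))) := by
      rw [D.proj01_eq x v]
      abel
    rw [h1, hodge_sub_left, D.hodge_H10_H01 x (D.proj10_mem x v) hu.2, zero_sub, neg_eq_zero]
    have h2 := (HermitianLinearAlgebra.mem_orthogonal _ _ u).1 hu.1 _
      (linearCombination_map_mem c (D.proj01 x) (Gi (D.polar x c (D.proj01 x v))))
    rw [← D.hodge_conj_symm]
    exact (congrArg (starRingEnd ℂ) h2).trans (map_zero _)

omit hiso in
-- Here `Λ π^{1,0} J = G`, hence the minus sign; the correction lies in the span of the
-- `π^{1,0}c_i`, which are orthogonal to the target by `hodge_proj10`.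
theorem orthProj_map_conj_perp01 [FiniteDimensional ℂ F] (hreal : ∀ i, D.conj x (c i) = c i)
    (Gi : (Fin k → ℂ) →ₗ[ℂ] (Fin k → ℂ)) (hGi : ∀ a, D.gramEnd x c (Gi a) = a) :
    D.orthProj x ((D.perp01 x (Submodule.span ℂ
        (Set.range fun i => D.proj01 x (c i)))).map (D.conj x)) =
      D.proj10 x - D.proj10 x ∘ₗ Fintype.linearCombination ℂ c ∘ₗ Gi ∘ₗ D.polar x c ∘ₗ
        D.proj10 x := by
  refine D.orthProj_eq x (fun v => ?_) fun v u hu => ?_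
  · rw [D.mem_map_conj_perp01_span x c hreal]
    simp only [LinearMap.sub_apply, LinearMap.comp_apply]
    refine ⟨Submodule.sub_mem _ (D.proj10_mem x _) (D.proj10_mem x _), ?_⟩
    rw [map_sub]
    exact sub_eq_zero.2 (hGi _).symm
  · rw [D.mem_map_conj_perp01_span x c hreal] at hu
    obtain ⟨hu1, hu2⟩ := hu
    simp only [LinearMap.sub_apply, LinearMap.comp_apply]
    rw [← sub_add, ← D.proj01_eq, hodge_add_left, D.hodge_H01_H10 x (D.proj01_mem x v) hu1,
      zero_add, ← D.hodge_conj_symm]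
    generalize Gi (D.polar x c (D.proj10 x v)) = a
    have h1 : D.hodge x u (D.proj10 x (Fintype.linearCombination ℂ c a)) =
        ∑ i, starRingEnd ℂ (a i) * D.hodge x u (D.proj10 x (c i)) := by
      simp [hodge, Fintype.linearCombination_apply]
    rw [h1, Finset.sum_eq_zero, map_zero]
    intro i _
    have h2 := congrFun hu2 i
    rw [polar_apply, Pi.zero_apply] at h2
    rw [D.hodge_proj10 x hu1 (hreal i)]
    linear_combination (starRingEnd ℂ (a i) / 2) * h2

end Isotropic

end PolarizedVHS

end

noncomputable section

theorem IsFlatAt.isHolomorphicAt {B : Type*} [TopologicalSpace B]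
    {F : Type*} [NormedAddCommGroup F] [NormedSpace ℂ F]
    {V : B → Type*} [∀ x, AddCommGroup (V x)] [∀ x, TopologicalSpace (V x)]
    [TopologicalSpace (TotalSpace F V)] [FiberBundle F V]
    (E : Type*) [NormedAddCommGroup E] [NormedSpace ℂ E] [ChartedSpace E B]
    {s : ∀ y, V y} {x : B} (hs : IsFlatAt F s x) : IsHolomorphicAt F E s x := fun e _ hx =>
  (contMDiffAt_const (c := (e ⟨x, s x⟩).2)).congr_of_eventuallyEq (hs e hx)

/-! ### Flat transport over `U`, and `σ`, `σ†` as derivatives of the projection -/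

namespace PolarizedVHS

variable {B : Type*} [TopologicalSpace B]
  {E : Type*} [NormedAddCommGroup E] [NormedSpace ℂ E] [ChartedSpace E B]
  {F : Type*} [NormedAddCommGroup F] [NormedSpace ℂ F]
  {V : B → Type*} [∀ x, AddCommGroup (V x)] [∀ x, Module ℂ (V x)] [∀ x, TopologicalSpace (V x)]
  [TopologicalSpace (TotalSpace F V)] [FiberBundle F V] [VectorBundle ℂ F V]
  (D : PolarizedVHS E F V)

variable (F) in
theorem eventually_linearMapAt_eq {s : ∀ y, V y}
    (e : Trivialization F (TotalSpace.proj : TotalSpace F V → B)) [MemTrivializationAtlas e]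
    {x : B} (hx : x ∈ e.baseSet) (hs : IsFlatAt F s x) :
    ∀ᶠ y in 𝓝 x, e.linearMapAt ℂ y (s y) = e.linearMapAt ℂ x (s x) := by
  filter_upwards [hs e hx, e.open_baseSet.mem_nhds hx] with y h1 h2
  rw [e.coe_linearMapAt_of_mem h2, e.coe_linearMapAt_of_mem hx]
  exact h1

theorem linearIndependent_realFiber_iff {k : ℕ}
    (e : Trivialization F (TotalSpace.proj : TotalSpace F V → B)) [MemTrivializationAtlas e]
    {x : B} (hx : x ∈ e.baseSet) (c : Fin k → D.realFiber x) :
    LinearIndependent ℝ c ↔ LinearIndependent ℝ fun i => e.linearMapAt ℂ x (c i : V x) := by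
  let L : D.realFiber x →ₗ[ℝ] F := ((e.linearMapAt ℂ x).restrictScalars ℝ) ∘ₗ
    (D.realFiber x).subtype
  have hL : LinearMap.ker L = ⊥ := by
    rw [LinearMap.ker_eq_bot']
    intro v hv
    have h := congrArg (e.symmₗ ℂ x) (show e.linearMapAt ℂ x (v : V x) = 0 from hv)
    rw [e.symmₗ_linearMapAt hx, map_zero] at h
    exact Subtype.ext h
  exact (L.linearIndependent_iff hL).symm

/-- In a flat trivialization the sections and their `Q`-pairings are locally constant, so both
properties are locally constant on `U`, and connectedness carries them from `b` to `x`. -/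
theorem linearIndependent_and_isotropic {U : Set B} (hU' : IsPreconnected U)
    {b : B} (hb : b ∈ U) {k : ℕ} (c : Fin k → ∀ y, D.realFiber y)
    (c_flat : ∀ i, ∀ y ∈ U, IsFlatAt F (fun y => (c i y : V y)) y)
    (c_indep : LinearIndependent ℝ (fun i => c i b))
    (c_isotropic : ∀ i j, D.Q b (c i b) (c j b) = 0) {x : B} (hx : x ∈ U) :
    LinearIndependent ℝ (fun i => c i x) ∧ ∀ i j, D.Q x (c i x) (c j x) = 0 := by
  let P : B → Prop := fun y =>
    LinearIndependent ℝ (fun i => c i y) ∧ ∀ i j, D.Q y (c i y) (c j y) = 0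
  have key : P b ↔ P x := by
    refine hU'.induction₂ (fun y z => P y ↔ P z) (fun y hy => nhdsWithin_le_nhds ?_)
      (fun _ _ _ _ _ _ h h' => h.trans h') (fun _ _ _ _ h => h.symm) hb hx
    set e := trivializationAt F V y
    have he : y ∈ e.baseSet := FiberBundle.mem_baseSet_trivializationAt' y
    have h1 : ∀ᶠ z in 𝓝 y, ∀ i, e.linearMapAt ℂ z (c i z : V z) = e.linearMapAt ℂ y (c i y : V y) :=
      Filter.eventually_all.2 fun i => eventually_linearMapAt_eq F e he (c_flat i y hy)
    have h2 : ∀ᶠ z in 𝓝 y, ∀ i j, D.Q z (c i z) (c j z) = D.Q y (c i y) (c j y) :=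
      Filter.eventually_all.2 fun i => Filter.eventually_all.2 fun j =>
        D.Q_flat _ _ y (c_flat i y hy) (c_flat j y hy)
    filter_upwards [h1, h2, e.open_baseSet.mem_nhds he] with z h1 h2 h3
    refine and_congr ?_ (forall_congr' fun i => forall_congr' fun j => by rw [h2])
    rw [D.linearIndependent_realFiber_iff e he, D.linearIndependent_realFiber_iff e h3]
    simp only [h1]
  exact key.1 ⟨c_indep, c_isotropic⟩

section FiniteDimensional

variable [FiniteDimensional ℂ F]

/-- The operator on the fiber at `x` which corresponds to the operator `A` on the model fiber. -/
def ofModel (x : B) (A : F →L[ℂ] F) : V x →ₗ[ℂ] V x :=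
  (trivializationAt F V x).symmₗ ℂ x ∘ₗ A.toLinearMap ∘ₗ
    (trivializationAt F V x).linearMapAt ℂ x

/-- The `(1,0)`-part of the derivative of the projection to `H^{1,0}`. -/
def delProj (x : B) (u : TangentSpace 𝓘(ℂ, E) x) : F →L[ℂ] F :=
  delAt (D.proj10Chart (E := E) (trivializationAt F V x) x) (extChartAt 𝓘(ℂ, E) x x) u

/-- The `(0,1)`-part of the derivative of the projection to `H^{1,0}`. -/
def delbarProj (x : B) (u : TangentSpace 𝓘(ℂ, E) x) : F →L[ℂ] F :=
  delbarAt (D.proj10Chart (E := E) (trivializationAt F V x) x) (extChartAt 𝓘(ℂ, E) x x) u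

theorem proj10Chart_apply_linearMapAt (x : B) (w : V x) :
    D.proj10Chart (E := E) (trivializationAt F V x) x (extChartAt 𝓘(ℂ, E) x x)
      ((trivializationAt F V x).linearMapAt ℂ x w) =
      (trivializationAt F V x).linearMapAt ℂ x (D.proj10 x w) := by
  rw [proj10Chart, extChartAt_to_inv,
    D.proj10In_linearMapAt _ (FiberBundle.mem_baseSet_trivializationAt' x)]

theorem proj10_symmₗ (x : B) (w : F) :
    D.proj10 x ((trivializationAt F V x).symmₗ ℂ x w) = (trivializationAt F V x).symmₗ ℂ x
      (D.proj10Chart (E := E) (trivializationAt F V x) x (extChartAt 𝓘(ℂ, E) x x) w) := by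
  have hx := FiberBundle.mem_baseSet_trivializationAt' (F := F) (E := V) x
  have h := D.proj10Chart_apply_linearMapAt x ((trivializationAt F V x).symmₗ ℂ x w)
  rw [Trivialization.linearMapAt_symmₗ _ hx] at h
  rw [h, Trivialization.symmₗ_linearMapAt _ hx]

variable [IsFlatBundle F V]

theorem isHodgeFamily_trivializationAt (x : B) :
    IsHodgeFamily (D.conjIn (trivializationAt F V x) x) (D.QIn (trivializationAt F V x) x)
      (D.proj10Chart (trivializationAt F V x) x : E → F →L[ℂ] F) (extChartAt 𝓘(ℂ, E) x x) :=
  D.isHodgeFamily _ (FiberBundle.mem_baseSet_trivializationAt' x)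

theorem delbarProj_proj10 (x : B) (u : TangentSpace 𝓘(ℂ, E) x) (w : V x) :
    ofModel x (D.delbarProj x u) (D.proj10 x w) = 0 := by
  have h := (D.isHodgeFamily_trivializationAt x).eventually_delbarAt_mul.self_of_nhds u
  have h2 := congrArg (fun A : F →L[ℂ] F => A ((trivializationAt F V x).linearMapAt ℂ x w)) h
  rw [ofModel, LinearMap.comp_apply, LinearMap.comp_apply, ← D.proj10Chart_apply_linearMapAt]
  exact (congrArg _ h2).trans (map_zero _)

theorem proj10_delbarProj (x : B) (u : TangentSpace 𝓘(ℂ, E) x) (w : V x) :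
    D.proj10 x (ofModel x (D.delbarProj x u) w) = ofModel x (D.delbarProj x u) w := by
  have h := (D.isHodgeFamily_trivializationAt x).eventually_mul_delbarAt.self_of_nhds u
  have h2 := congrArg (fun A : F →L[ℂ] F => A ((trivializationAt F V x).linearMapAt ℂ x w)) h
  rw [ofModel, LinearMap.comp_apply, LinearMap.comp_apply, D.proj10_symmₗ]
  exact congrArg _ h2

theorem delProj_proj10 (x : B) (u : TangentSpace 𝓘(ℂ, E) x) (w : V x) :
    ofModel x (D.delProj x u) (D.proj10 x w) = ofModel x (D.delProj x u) w := by
  have h := (D.isHodgeFamily_trivializationAt x).eventually_delAt_mul.self_of_nhds u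
  have h2 := congrArg (fun A : F →L[ℂ] F => A ((trivializationAt F V x).linearMapAt ℂ x w)) h
  rw [ofModel, LinearMap.comp_apply, LinearMap.comp_apply, ← D.proj10Chart_apply_linearMapAt]
  exact congrArg _ h2

theorem proj10_delProj (x : B) (u : TangentSpace 𝓘(ℂ, E) x) (w : V x) :
    D.proj10 x (ofModel x (D.delProj x u) w) = 0 := by
  have h := (D.isHodgeFamily_trivializationAt x).eventually_mul_delAt.self_of_nhds u
  have h2 := congrArg (fun A : F →L[ℂ] F => A ((trivializationAt F V x).linearMapAt ℂ x w)) h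
  rw [ofModel, LinearMap.comp_apply, LinearMap.comp_apply, D.proj10_symmₗ]
  exact (congrArg _ h2).trans (map_zero _)

/-- Of `dp = ∂p + ∂̄p`, the second part vanishes on `H^{1,0}`. The first vanishes on `H^{0,1}` and
takes values there, so both projections in the definition of `σ` are redundant. -/
theorem secondFundamentalForm_eq (x : B) (u : TangentSpace 𝓘(ℂ, E) x) :
    D.secondFundamentalForm x u = ofModel x (D.delProj x u) := by
  have hx := FiberBundle.mem_baseSet_trivializationAt' (F := F) (E := V) x
  have hd := dirDeriv_eq_fderiv (D.mdifferentiableAt_proj10In (trivializationAt F V x) x hx) u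
  have hsum : dirDeriv (D.proj10In (trivializationAt F V x)) x u =
      D.delProj x u + D.delbarProj x u :=
    hd.trans (delAt_add_delbarAt _ _ _).symm
  ext w
  change D.proj01 x ((trivializationAt F V x).symmₗ ℂ x
    (dirDeriv (D.proj10In (trivializationAt F V x)) x u
      ((trivializationAt F V x).linearMapAt ℂ x (D.proj10 x w)))) = _
  rw [hsum, add_apply, map_add]
  change D.proj01 x (ofModel x (D.delProj x u) (D.proj10 x w) +
    ofModel x (D.delbarProj x u) (D.proj10 x w)) = _
  rw [D.delbarProj_proj10, add_zero, D.delProj_proj10, D.proj01_eq, D.proj10_delProj, sub_zero]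

theorem conj_delbarProj_conj (x : B) (u : TangentSpace 𝓘(ℂ, E) x) (w : V x) :
    D.conj x (ofModel x (D.delbarProj x u) (D.conj x w)) = - ofModel x (D.delProj x u) w := by
  have hx := FiberBundle.mem_baseSet_trivializationAt' (F := F) (E := V) x
  have h := (D.isHodgeFamily_trivializationAt x).eventually_conj_delbarAt.self_of_nhds u
    ((trivializationAt F V x).linearMapAt ℂ x w)
  have h2 := congrArg ((trivializationAt F V x).symmₗ ℂ x) h
  simp only [conjIn, LinearMap.comp_apply, Trivialization.symmₗ_linearMapAt _ hx, map_neg] at h2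
  exact h2

theorem Q_delbarProj (x : B) (u : TangentSpace 𝓘(ℂ, E) x) (v w : V x) :
    D.Q x (ofModel x (D.delbarProj x u) v) w = - D.Q x v (ofModel x (D.delbarProj x u) w) := by
  have hx := FiberBundle.mem_baseSet_trivializationAt' (F := F) (E := V) x
  have h := (D.isHodgeFamily_trivializationAt x).q_delbarAt u
    ((trivializationAt F V x).linearMapAt ℂ x v) ((trivializationAt F V x).linearMapAt ℂ x w)
  simp only [QIn, LinearMap.compl₁₂_apply, Trivialization.symmₗ_linearMapAt _ hx] at h
  exact h

/-- Conjugation turns `∂p` into `-∂̄p`, skewness moves it across `Q`, and `∂̄p` anticommutes with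
the Weil operator, as it maps `H^{0,1}` to `H^{1,0}` and kills `H^{1,0}`. -/
theorem adjoint_secondFundamentalForm (x : B) (u : TangentSpace 𝓘(ℂ, E) x) :
    D.adjoint x (D.secondFundamentalForm x u) = -ofModel x (D.delbarProj x u) := by
  refine D.adjoint_eq x fun a v => ?_
  have h1 : D.conj x (ofModel x (D.delProj x u) a) =
      - ofModel x (D.delbarProj x u) (D.conj x a) := by
    rw [← neg_eq_iff_eq_neg, ← map_neg, ← D.conj_delbarProj_conj, D.conj_conj]
  have h2 : ofModel x (D.delbarProj x u) (D.weil x v) =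
      -(I • ofModel x (D.delbarProj x u) v) := by
    simp [weil, D.proj01_eq, D.delbarProj_proj10]
  have h3 : D.weil x (ofModel x (D.delbarProj x u) v) = I • ofModel x (D.delbarProj x u) v :=
    D.weil_of_mem x (by rw [← D.proj10_delbarProj]; exact D.proj10_mem x _)
  rw [D.secondFundamentalForm_eq, hodge, hodge, h1, LinearMap.neg_apply, map_neg, map_neg, h3,
    ← D.Q_delbarProj, h2]

end FiniteDimensional

end PolarizedVHS

end

noncomputable section

/-! ### The Gram endomorphism on the model fiber -/

namespace PolarizedVHS

variable {B : Type*} [TopologicalSpace B]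
  {E : Type*} [NormedAddCommGroup E] [NormedSpace ℂ E] [ChartedSpace E B]
  {F : Type*} [NormedAddCommGroup F] [NormedSpace ℂ F]
  {V : B → Type*} [∀ x, AddCommGroup (V x)] [∀ x, Module ℂ (V x)] [∀ x, TopologicalSpace (V x)]
  [TopologicalSpace (TotalSpace F V)] [FiberBundle F V] [VectorBundle ℂ F V]
  (D : PolarizedVHS E F V) [FiniteDimensional ℂ F]

/-- The map `ℂᵏ → F` given by a family of vectors of the fiber at `x`. -/
def familyIn (x : B) {k : ℕ} (c : Fin k → V x) : (Fin k → ℂ) →L[ℂ] F :=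
  LinearMap.toContinuousLinearMap
    ((trivializationAt F V x).linearMapAt ℂ x ∘ₗ Fintype.linearCombination ℂ c)

/-- The functionals `2i Q(·, c_j)`, on the model fiber. -/
def polarIn (x : B) {k : ℕ} (c : Fin k → V x) : F →L[ℂ] (Fin k → ℂ) :=
  LinearMap.toContinuousLinearMap (D.polar x c ∘ₗ (trivializationAt F V x).symmₗ ℂ x)

theorem polarIn_proj10Chart_familyIn (x : B) {k : ℕ} (c : Fin k → V x) :
    ((D.polarIn x c ∘L D.proj10Chart (E := E) (trivializationAt F V x) x
      (extChartAt 𝓘(ℂ, E) x x) ∘L familyIn x c : (Fin k → ℂ) →L[ℂ] (Fin k → ℂ)) :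
      (Fin k → ℂ) →ₗ[ℂ] (Fin k → ℂ)) = D.gramEnd x c := by
  have hx := FiberBundle.mem_baseSet_trivializationAt' (F := F) (E := V) x
  refine LinearMap.ext fun a => ?_
  change D.polar x c ((trivializationAt F V x).symmₗ ℂ x (D.proj10Chart (E := E)
    (trivializationAt F V x) x (extChartAt 𝓘(ℂ, E) x x) ((trivializationAt F V x).linearMapAt ℂ x
      (Fintype.linearCombination ℂ c a)))) = _
  rw [D.proj10Chart_apply_linearMapAt, Trivialization.symmₗ_linearMapAt _ hx]
  rfl

/-- When the family and the polarization at `y` read as they do at `x`, only the projection depends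
on `y`. -/
theorem gramEnd_eq (x : B) {k : ℕ} (c : Fin k → V x) {y : B} (c' : Fin k → V y)
    (hy : y ∈ (trivializationAt F V x).baseSet)
    (hc : ∀ i, (trivializationAt F V x).linearMapAt ℂ y (c' i) =
      (trivializationAt F V x).linearMapAt ℂ x (c i))
    (hQ : ∀ v w : F, D.Q y ((trivializationAt F V x).symmₗ ℂ y v)
      ((trivializationAt F V x).symmₗ ℂ y w) =
        D.Q x ((trivializationAt F V x).symmₗ ℂ x v) ((trivializationAt F V x).symmₗ ℂ x w)) :
    D.gramEnd y c' = ((D.polarIn x c ∘L D.proj10In (trivializationAt F V x) y ∘L familyIn x c :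
      (Fin k → ℂ) →L[ℂ] (Fin k → ℂ)) : (Fin k → ℂ) →ₗ[ℂ] (Fin k → ℂ)) := by
  have hx := FiberBundle.mem_baseSet_trivializationAt' (F := F) (E := V) x
  have h1 : ∀ a, (trivializationAt F V x).linearMapAt ℂ y (Fintype.linearCombination ℂ c' a) =
      (trivializationAt F V x).linearMapAt ℂ x (Fintype.linearCombination ℂ c a) := fun a => by
    simp only [Fintype.linearCombination_apply, map_sum, map_smul, hc]
  have h2 : ∀ w : F, D.polar y c' ((trivializationAt F V x).symmₗ ℂ y w) =
      D.polar x c ((trivializationAt F V x).symmₗ ℂ x w) := fun w => by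
    ext j
    rw [polar_apply, polar_apply, ← Trivialization.symmₗ_linearMapAt (R := ℂ) _ hy (c' j), hc, hQ,
      Trivialization.symmₗ_linearMapAt _ hx]
  refine LinearMap.ext fun a => ?_
  change D.polar y c' (D.proj10 y (Fintype.linearCombination ℂ c' a)) =
    D.polar x c ((trivializationAt F V x).symmₗ ℂ x (D.proj10In (trivializationAt F V x) y
      ((trivializationAt F V x).linearMapAt ℂ x (Fintype.linearCombination ℂ c a))))
  rw [← h2, ← h1, D.proj10In_linearMapAt _ hy, Trivialization.symmₗ_linearMapAt _ hy]

theorem trace_identity [IsFlatBundle F V] (x : B) {k : ℕ} (c : Fin k → V x) (hreal : ∀ i, D.conj x (c i) = c i)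
    (hiso : ∀ i j, D.Q x (c i) (c j) = 0) (Gi : (Fin k → ℂ) →L[ℂ] (Fin k → ℂ))
    (hGi : ∀ a, D.gramEnd x c (Gi a) = a) (u v : TangentSpace 𝓘(ℂ, E) x) :
    traceCLM (Fin k → ℂ) (Gi * (D.polarIn x c ∘L (D.delProj x u * D.delbarProj x v -
        D.delbarProj x v * D.delProj x u) ∘L familyIn x c)) -
      traceCLM (Fin k → ℂ) (Gi * (D.polarIn x c ∘L D.delProj x u ∘L familyIn x c) *
        Gi * (D.polarIn x c ∘L D.delbarProj x v ∘L familyIn x c)) =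
    LinearMap.trace ℂ (V x) (D.secondFundamentalForm x u ∘ₗ
        D.adjoint x (D.secondFundamentalForm x v)) -
      LinearMap.trace ℂ (V x) (D.secondFundamentalForm x u ∘ₗ
        D.orthProj x ((D.perp01 x (Submodule.span ℂ (Set.range fun i =>
          D.proj01 x (c i)))).map (D.conj x)) ∘ₗ
        D.adjoint x (D.secondFundamentalForm x v) ∘ₗ
        D.orthProj x (D.perp01 x (Submodule.span ℂ (Set.range fun i => D.proj01 x (c i))))) := by
  have hx := FiberBundle.mem_baseSet_trivializationAt' (F := F) (E := V) x
  have := finiteDimensional_fiber F V x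
  have h01 : D.proj01 x = LinearMap.id - D.proj10 x := LinearMap.ext fun w => D.proj01_eq x w
  rw [D.orthProj_perp01 x c hiso hreal Gi hGi, D.orthProj_map_conj_perp01 x c hreal Gi hGi,
    D.adjoint_secondFundamentalForm, D.secondFundamentalForm_eq, h01,
    ← trace_projection_identity (D.proj10 x) (ofModel x (D.delProj x u))
      (ofModel x (D.delbarProj x v)) (Fintype.linearCombination ℂ c) (D.polar x c) Gi
      (D.delbarProj_proj10 x v) (D.proj10_delbarProj x v) (D.delProj_proj10 x u)
      (D.proj10_delProj x u)]
  -- Transport from the model fiber is multiplicative, so products of `∂p` and `∂̄p` can be formed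
  -- on either side.
  have hmul : ∀ A A' : F →L[ℂ] F, (ofModel x (A * A') : V x →ₗ[ℂ] V x) =
      ofModel x A ∘ₗ ofModel x A' := fun A A' => by
    ext w
    simp only [ofModel, LinearMap.comp_apply, ContinuousLinearMap.coe_coe,
      Trivialization.linearMapAt_symmₗ _ hx]
    rfl
  have hsub : ∀ A A' : F →L[ℂ] F, (ofModel x (A - A') : V x →ₗ[ℂ] V x) =
      ofModel x A - ofModel x A' := fun A A' => by
    ext w
    simp [ofModel]
  rw [← hmul, ← hmul, ← hsub]
  rfl

end PolarizedVHS

end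
-- The theorem
theorem mainTheorem11 {B : Type*} [TopologicalSpace B]
    {E : Type*} [NormedAddCommGroup E] [NormedSpace ℂ E] [FiniteDimensional ℂ E]
    [ChartedSpace E B] [IsManifold 𝓘(ℂ, E) ω B]
    {F : Type*} [NormedAddCommGroup F] [NormedSpace ℂ F] [FiniteDimensional ℂ F]
    {V : B → Type*} [∀ x, AddCommGroup (V x)] [∀ x, Module ℂ (V x)]
    [∀ x, TopologicalSpace (V x)] [TopologicalSpace (TotalSpace F V)]
    [FiberBundle F V] [VectorBundle ℂ F V] [IsFlatBundle F V]
    (D : PolarizedVHS E F V)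
    {k : ℕ} (U : Set B) (hU : IsOpen U) (hU' : IsPreconnected U) (b : B) (hb : b ∈ U)
    (c : Fin k → ∀ y, D.realFiber y)
    (c_flat : ∀ i, ∀ y ∈ U, IsFlatAt F (fun y => (c i y : V y)) y)
    (c_indep : LinearIndependent ℝ (fun i => c i b))
    (c_isotropic : ∀ i j, D.Q b (c i b) (c j b) = 0)
    (φ : Fin k → ∀ y, V y) (hφ : ∀ i y, φ i y = D.proj01 y (c i y)) :
    ∀ x ∈ U,
      (∀ i, D.IsHolomorphic01At (φ i) x) ∧
      LinearIndependent ℂ (fun i => φ i x) ∧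
      0 < D.wedgeNormSq x (exteriorPower.ιMulti ℝ k fun i => c i x) ∧
      ContMDiffAt 𝓘(ℝ, E) 𝓘(ℝ, ℝ) ∞
        (fun y => Real.log (D.wedgeNormSq y (exteriorPower.ιMulti ℝ k fun i => c i y))) x ∧
      ∀ u v : TangentSpace 𝓘(ℂ, E) x,
        ddbar (fun y =>
          ((Real.log (D.wedgeNormSq y (exteriorPower.ιMulti ℝ k fun i => c i y)) : ℝ) : ℂ)) x u v =
        LinearMap.trace ℂ (V x)
          (wedgeEnd (D.secondFundamentalForm x)
            (fun w => D.adjoint x (D.secondFundamentalForm x w)) u v) -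
        LinearMap.trace ℂ (V x)
          (wedgeEnd (D.secondFundamentalForm x)
            (fun w => D.orthProj x ((D.perp01 x (spanAt φ x)).map (D.conj x)) ∘ₗ
              D.adjoint x (D.secondFundamentalForm x w) ∘ₗ
              D.orthProj x (D.perp01 x (spanAt φ x))) u v) := by
  intro x hxU
  have hU_all : ∀ y ∈ U, _ := fun y hy =>
    D.linearIndependent_and_isotropic hU' hb c c_flat c_indep c_isotropic hy
  obtain ⟨hli, hiso⟩ := hU_all x hxU
  have hpos := D.wedgeNormSq_pos x _ hli
  have hdet : LinearMap.det (D.gramEnd x fun i => (c i x : V x)) ≠ 0 := by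
    rw [← D.wedgeNormSq_eq_det x _ hiso]
    exact_mod_cast hpos.ne'
  have hx := FiberBundle.mem_baseSet_trivializationAt' (F := F) (E := V) x
  have H := D.isHodgeFamily_trivializationAt x
  set z₀ := extChartAt 𝓘(ℂ, E) x x with hz₀
  let N : E → ℝ := fun z => D.wedgeNormSq ((extChartAt 𝓘(ℂ, E) x).symm z)
    (exteriorPower.ιMulti ℝ k fun i => c i ((extChartAt 𝓘(ℂ, E) x).symm z))
  let G : E → (Fin k → ℂ) →L[ℂ] (Fin k → ℂ) := fun z =>
    D.polarIn x (fun i => (c i x : V x)) ∘L D.proj10Chart (trivializationAt F V x) x z ∘L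
      PolarizedVHS.familyIn x fun i => (c i x : V x)
  have hψ := tendsto_extChartAt_symm (E := E) x
  have hNpos : ∀ᶠ z in 𝓝 z₀, 0 < N z := by
    filter_upwards [hψ.eventually (hU.mem_nhds hxU)] with z hz
      using D.wedgeNormSq_pos _ _ (hU_all _ hz).1
  have hNdet : ∀ᶠ z in 𝓝 z₀, (N z : ℂ) = (G z).det := by
    have hc : ∀ᶠ y in 𝓝 x, ∀ i, (trivializationAt F V x).linearMapAt ℂ y (c i y : V y) =
        (trivializationAt F V x).linearMapAt ℂ x (c i x : V x) :=
      Filter.eventually_all.2 fun i =>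
        PolarizedVHS.eventually_linearMapAt_eq F _ hx (c_flat i x hxU)
    filter_upwards [hψ.eventually (hU.mem_nhds hxU), hψ.eventually hc,
      hψ.eventually ((trivializationAt F V x).open_baseSet.mem_nhds hx),
      hψ.eventually (D.eventually_Q_eq _ hx)] with z h1 h2 h3 h4
    refine (D.wedgeNormSq_eq_det _ _ (hU_all _ h1).2).trans ?_
    rw [D.gramEnd_eq x (fun i => (c i x : V x)) _ h3 h2 h4]
    rfl
  -- The flat section `c_i` is itself a holomorphic lift of `φ_i`.
  refine ⟨fun i => ⟨fun y => c i y, IsFlatAt.isHolomorphicAt E (c_flat i x hxU),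
    Filter.Eventually.of_forall (hφ i)⟩, ?_, hpos, ?_, fun u v => ?_⟩
  · simp only [hφ]
    exact D.linearIndependent_proj01 x _ hiso hdet
  · refine contMDiffAt_of_contDiffAt_chart ?_
    have hΨ : ContDiff ℂ ω (fun A : F →L[ℂ] F => D.polarIn x (fun i => (c i x : V x)) ∘L A ∘L
        PolarizedVHS.familyIn x fun i => (c i x : V x)) :=
      contDiff_const.clm_comp (contDiff_id.clm_comp contDiff_const)
    have hG : ContDiffAt ℝ ω G z₀ :=
      (hΨ.restrict_scalars ℝ).contDiffAt.comp z₀ H.contDiffAt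
    have hD : ContDiffAt ℝ ω (fun z => (G z).det) z₀ :=
      (contDiff_det.restrict_scalars ℝ).contDiffAt.comp z₀ hG
    -- Near `z₀`, `N` is the real part of `det G`, which is real analytic.
    have hN : ContDiffAt ℝ ω N z₀ :=
      (Complex.reCLM.contDiff.contDiffAt.comp z₀ hD).congr_of_eventuallyEq
        (hNdet.mono fun z hz => by simp [← hz])
    exact (hN.log hNpos.self_of_nhds.ne').of_le le_top
  · have hspan : spanAt φ x = Submodule.span ℂ (Set.range fun i => D.proj01 x (c i x)) := by
      simp only [spanAt, hφ]
    have hG0 : (G z₀ : (Fin k → ℂ) →ₗ[ℂ] (Fin k → ℂ)) = D.gramEnd x fun i => (c i x : V x) :=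
      D.polarIn_proj10Chart_familyIn x _
    have hunit : IsUnit (G z₀) := isUnit_of_det_ne_zero (by
      rw [ContinuousLinearMap.det, hG0]; exact hdet)
    have hGi : ∀ a, D.gramEnd x (fun i => (c i x : V x)) (Ring.inverse (G z₀) a) = a := fun a => by
      rw [← hG0]
      exact congrArg (fun A : (Fin k → ℂ) →L[ℂ] (Fin k → ℂ) => A a)
        (Ring.mul_inverse_cancel _ hunit)
    have key : ∀ u v : TangentSpace 𝓘(ℂ, E) x,
        delAt (fun y => delbarAt (fun y => ((Real.log (N y) : ℝ) : ℂ)) y v) z₀ u = _ := fun u v =>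
      (H.delAt_delbarAt_log_det _ _ hNdet hNpos u v).trans
        (D.trace_identity x (fun i => (c i x : V x)) (fun i => (c i x).2) hiso _ hGi u v)
    have h1 : ddbar (fun y => ((Real.log (D.wedgeNormSq y
        (exteriorPower.ιMulti ℝ k fun i => c i y)) : ℝ) : ℂ)) x u v =
        delAt (fun y => delbarAt (fun y => ((Real.log (N y) : ℝ) : ℂ)) y v) z₀ u -
        delAt (fun y => delbarAt (fun y => ((Real.log (N y) : ℝ) : ℂ)) y u) z₀ v := rfl
    -- The identity for `(u, v)` minus the one for `(v, u)`: antisymmetrizing produces the wedge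
    -- products.
    rw [h1, key, key, hspan]
    simp only [wedgeEnd, map_sub]
    ring
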